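/- Let $R$ be a commutative artinian ring and let $\Lambda$ be an artin $R$-algebra (an $R$-algebra that is finitely generated as an $R$-module). Modules are finitely generated left $\Lambda$-modules. Let $D=\operatorname{Hom}_R(-,J)$ be the standard duality, where $J$ is the injective envelope of $R/\operatorname{rad}R$. Let $\widetilde Q$ be the direct sum of representatives of the isomorphism classes of all indecomposable projective-injective $\Lambda$-modules, and let $\mathcal C_\Lambda$ be the full subcategory of all modules $M$ for which there are an epimorphism $\widetilde Q^m\to M$ and a monomorphism $M\to\widetilde Q^{m'}$ for some $m,m'\ge 0$. A module $T$ is called tilting if it is basic (a direct sum of pairwise non-isomorphic indecomposable modules), $\operatorname{pd}T\le 1$, $\operatorname{Ext}^1_\Lambda(T,T)=0$, and there is an exact sequence $0\to\Lambda\to T_0\to T_1\to 0$ with $T_0,T_1\in\operatorname{add}T$. A module $C$ is called cotilting if $\operatorname{id}C\le 1$, $\operatorname{Ext}^1_\Lambda(C,C)=0$, and there is an exact sequence $0\to C_0\to C_1\to D\Lambda\to 0$ with $C_0,C_1\in\operatorname{add}C$. A tilting-cotilting module is a module that is both tilting and cotilting. The dominant dimension $\operatorname{dom.dim}\Lambda$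 is the supremum of all $k$ such that the terms $I_0,\dots,I_{k-1}$ of a minimal injective resolution $0\to{}_\Lambda\Lambda\to I_0\to I_1\to\cdots$ are projective. An Auslander algebra is an artin algebra $\Lambda$ with $\operatorname{gl.dim}\Lambda\le 2\le\operatorname{dom.dim}\Lambda$. Assume that $\operatorname{gl.dim}\Lambda<\infty$. Then $\mathcal C_\Lambda$ contains a tilting-cotilting module if and only if $\Lambda$ is an Auslander algebra. -/

import Mathlib

open CategoryTheory

universe u

namespace ArtinAlg

section General

variable {S : Type u} [Ring S]

/-- `f : M → E` is an injective envelope: `f` is a monomorphism, `E` is injective, and the image of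
`f` is an essential submodule of `E`. -/
structure IsInjectiveEnvelope {M E : ModuleCat.{u} S} (f : M →ₗ[S] E) : Prop where
  injective : Function.Injective f
  injective_module : Module.Injective S E
  essential : ∀ N : Submodule S E, N ⊓ LinearMap.range f = ⊥ → N = ⊥

/-- A minimal injective resolution `0 → M → I₀ → I₁ → ⋯` of `M`: an exact sequence with all `Iₙ`
injective in which each `Iₙ` is an essential extension of the image of the map arriving at it. -/
structure MinimalInjectiveResolution (M : ModuleCat.{u} S) where
  I : ℕ → ModuleCat.{u} S
  ε : M →ₗ[S] I 0
  d : ∀ n, I n →ₗ[S] I (n + 1)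
  injective_module : ∀ n, Module.Injective S (I n)
  injective_ε : Function.Injective ε
  exact_zero : Function.Exact ε (d 0)
  exact_succ : ∀ n, Function.Exact (d n) (d (n + 1))
  essential_zero : ∀ N : Submodule S (I 0), N ⊓ LinearMap.range ε = ⊥ → N = ⊥
  essential_succ : ∀ n, ∀ N : Submodule S (I (n + 1)), N ⊓ LinearMap.range (d n) = ⊥ → N = ⊥

/-- The dominant dimension of a module: the supremum of all `k` such that the terms `Iᵢ`, `i < k`,
of a minimal injective resolution (unique up to isomorphism) are projective. -/
noncomputable def moduleDomDim (M : ModuleCat.{u} S) : ℕ∞ :=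
  ⨆ (k : ℕ) (_ : ∃ J : MinimalInjectiveResolution M, ∀ i < k, Module.Projective S (J.I i)), (k : ℕ∞)

variable (S) in
/-- The (left) dominant dimension of the ring `S`, that is, of the left module `S`. -/
noncomputable def domDim : ℕ∞ := moduleDomDim (ModuleCat.of S S)

variable (S) in
/-- The global dimension: the supremum of the projective dimensions of the finitely generated left
modules (it is `⊥` only if `S` is the zero ring). -/
noncomputable def globalDim : WithBot ℕ∞ :=
  ⨆ (M : ModuleCat.{u} S) (_ : Module.Finite S M), projectiveDimension M

variable (S) in
/-- Auslander algebras: `gl.dim ≤ 2 ≤ dom.dim`. -/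
def IsAuslander : Prop := globalDim S ≤ 2 ∧ 2 ≤ domDim S

/-- `X` lies in `add T`: it is a direct summand of a finite power of `T`. -/
def InAdd (T X : ModuleCat.{u} S) : Prop :=
  ∃ (n : ℕ) (i : X →ₗ[S] (Fin n → T)) (p : (Fin n → T) →ₗ[S] X), p ∘ₗ i = LinearMap.id

/-- `M` is generated by `X`: there is an epimorphism `X ^ m → M`. -/
def InGen (X M : ModuleCat.{u} S) : Prop :=
  ∃ (m : ℕ) (f : (Fin m → X) →ₗ[S] M), Function.Surjective f

/-- `M` is cogenerated by `X`: there is a monomorphism `M → X ^ m`. -/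
def InCogen (X M : ModuleCat.{u} S) : Prop :=
  ∃ (m : ℕ) (f : M →ₗ[S] (Fin m → X)), Function.Injective f

/-- `P` is a finitely generated indecomposable projective-injective module. -/
structure IsIndecProjInj (P : ModuleCat.{u} S) : Prop where
  finite : Module.Finite S P
  indecomposable : Indecomposable P
  projective : Module.Projective S P
  injective : Module.Injective S P

/-- `Q` is the direct sum of representatives `Q₁, …, Qₜ` of the isomorphism classes of all
finitely generated indecomposable projective-injective modules. -/
def IsProjInjSum (Q : ModuleCat.{u} S) : Prop :=
  ∃ (t : ℕ) (X : Fin t → ModuleCat.{u} S),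
    (∀ i, IsIndecProjInj (X i)) ∧
    (∀ i j, Nonempty (X i ≃ₗ[S] X j) → i = j) ∧
    (∀ P : ModuleCat.{u} S, IsIndecProjInj P → ∃ i, Nonempty (P ≃ₗ[S] X i)) ∧
    Nonempty (Q ≃ₗ[S] ((i : Fin t) → X i))

/-- The objects of the subcategory `C_S`: the finitely generated modules that are generated and
cogenerated by the direct sum `Q` of all indecomposable projective-injective modules (which is
unique up to isomorphism). -/
def InC (M : ModuleCat.{u} S) : Prop :=
  Module.Finite S M ∧ ∃ Q : ModuleCat.{u} S, IsProjInjSum Q ∧ InGen Q M ∧ InCogen Q M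

/-- `T` is basic: a finite direct sum of pairwise non-isomorphic indecomposable modules. -/
def IsBasic (T : ModuleCat.{u} S) : Prop :=
  ∃ (n : ℕ) (X : Fin n → ModuleCat.{u} S),
    (∀ i, Indecomposable (X i)) ∧
    (∀ i j, Nonempty (X i ≃ₗ[S] X j) → i = j) ∧
    Nonempty (T ≃ₗ[S] ((i : Fin n) → X i))

/-- Classical tilting modules. -/
structure IsTilting (T : ModuleCat.{u} S) : Prop where
  finite : Module.Finite S T
  basic : IsBasic T
  pd_le_one : projectiveDimension T ≤ 1
  ext_self : Subsingleton (Abelian.Ext.{u} T T 1)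
  coresolution : ∃ (T₀ T₁ : ModuleCat.{u} S) (f : S →ₗ[S] T₀) (g : T₀ →ₗ[S] T₁),
    InAdd T T₀ ∧ InAdd T T₁ ∧
    Function.Injective f ∧ Function.Exact f g ∧ Function.Surjective g

end General

section Dual

variable (R : Type u) [CommRing R] (A : Type u) [Ring A] [Algebra R A] (J : Type u)
  [AddCommGroup J] [Module R J]

/-- `Hom_R(A, J)`, as a left `A`-module by `(a • φ) x = φ (x * a)`. -/
def RegularDual : Type u := A →ₗ[R] J

noncomputable instance : AddCommGroup (RegularDual R A J) :=
  inferInstanceAs (AddCommGroup (A →ₗ[R] J))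

noncomputable instance : Module A (RegularDual R A J) where
  smul a φ := LinearMap.comp (show A →ₗ[R] J from φ) (LinearMap.mulRight R a)
  one_smul φ := LinearMap.ext fun x => congrArg (show A →ₗ[R] J from φ) (mul_one x)
  mul_smul a b φ :=
    LinearMap.ext fun x => congrArg (show A →ₗ[R] J from φ) (mul_assoc x a b).symm
  smul_zero _ := rfl
  smul_add _ _ _ := rfl
  add_smul a b φ := LinearMap.ext fun x =>
    (congrArg (show A →ₗ[R] J from φ) (mul_add x a b)).trans
      (map_add (show A →ₗ[R] J from φ) _ _)
  zero_smul φ := LinearMap.ext fun x =>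
    (congrArg (show A →ₗ[R] J from φ) (mul_zero x)).trans (map_zero (show A →ₗ[R] J from φ))

end Dual

/-- Classical cotilting modules over an artin `R`-algebra `A`. Here `J` is the injective envelope of
`R / rad R` (unique up to isomorphism), so that `D = Hom_R(-, J)` is the standard duality and
`RegularDual R A J` is the left module `D A`. -/
structure IsCotilting (R : Type u) [CommRing R] {A : Type u} [Ring A] [Algebra R A]
    (C : ModuleCat.{u} A) : Prop where
  finite : Module.Finite A C
  id_le_one : injectiveDimension C ≤ 1
  ext_self : Subsingleton (Abelian.Ext.{u} C C 1)
  resolution : ∃ (J : ModuleCat.{u} R)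
      (e : ModuleCat.of R (R ⧸ Ring.jacobson R) →ₗ[R] J), IsInjectiveEnvelope e ∧
    ∃ (C₀ C₁ : ModuleCat.{u} A) (f : C₀ →ₗ[A] C₁) (g : C₁ →ₗ[A] RegularDual R A J),
      InAdd C C₀ ∧ InAdd C C₁ ∧
      Function.Injective f ∧ Function.Exact f g ∧ Function.Surjective g

end ArtinAlg

/-! Suppose `T` in `C_Λ` is tilting with `id T ≤ 1`, and let `Q` be the sum of the indecomposable
projective-injectives. The tilting coresolution embeds `Λ` in a power of `T`, hence of `Q`, and this
forces `Q ∈ add T`. Let `f : Λ → Q^m` be a left `add Q`-approximation with cokernel `K`. The crux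
(`exists_embedding_cokernel_inAdd`) is that `K ∈ add T`: a right `add T`-approximation `T^n → K` has
kernel generated by `T`, hence by `Q` (`exists_approximation_of_inGen`), and the approximation
property of `f` allows a lift `Q^m → T^n` to be corrected until it kills `Λ`, which splits `T^n →
K`.

Now `K` is cogenerated by `Q`, so the first two terms of the minimal injective resolution of `Λ` lie
in `add Q` and `dom.dim Λ ≥ 2` (`two_le_domDim`). Also `id K ≤ 1`, so `id Λ ≤ 2`. Finite projective
dimensions are then at most 2 (`hasProjectiveDimensionLT_three`), and finiteness of `gl.dim Λ` gives
`gl.dim Λ ≤ 2`.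

Conversely, let `Λ` be Auslander, `0 → Λ → I₀ → I₁` the start of a minimal injective resolution and
`K` the image of `I₀ → I₁`. The basic module `T` with `add T = add (I₀ ⊕ K)` works. Dimension
shifting with `gl.dim Λ ≤ 2` gives `pd T ≤ 1`, `id T ≤ 1` and `Ext¹(T, T) = 0`, and `0 → Λ → I₀ → K
→ 0` is the tilting coresolution. For the cotilting resolution, two successive `add
T`-approximations starting from `DΛ` are taken; the second splits because its `Ext¹` obstruction is
controlled by `Ext³(DΛ, -) = 0` (`exists_isTilting_isCotilting`). -/

namespace ArtinAlg

open Abelian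

/-! ### Vanishing of Ext; the calculus of add, Gen and Cogen. -/

section HomologicalTools

variable {S : Type u} [Ring S]

/-- The short complex given by a short exact sequence of linear maps. -/
abbrev shortComplexOfExact {X Y Z : ModuleCat.{u} S} (f : X →ₗ[S] Y) (g : Y →ₗ[S] Z)
    (h : Function.Exact f g) : ShortComplex (ModuleCat.{u} S) :=
  ModuleCat.shortComplexOfCompEqZero f g h.linearMap_comp_eq_zero

section ShortExact

variable {X Y Z : ModuleCat.{u} S} {f : X →ₗ[S] Y} {g : Y →ₗ[S] Z}

lemma shortExact_of_exact (hf : Function.Injective f) (h : Function.Exact f g)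
    (hg : Function.Surjective g) : (shortComplexOfExact f g h).ShortExact :=
  ModuleCat.shortComplex_shortExact _ h hf hg

lemma exists_extension_of_ext_one (hf : Function.Injective f) (h : Function.Exact f g)
    (hg : Function.Surjective g) {W : ModuleCat.{u} S} (hW : Subsingleton (Ext.{u} Z W 1))
    (φ : X →ₗ[S] W) : ∃ ψ : Y →ₗ[S] W, ψ ∘ₗ f = φ := by
  obtain ⟨x₂, hx₂⟩ := Ext.contravariant_sequence_exact₁ (shortExact_of_exact hf h hg) W
    (Ext.mk₀ (ModuleCat.ofHom φ)) (add_zero 1) (Subsingleton.elim _ _)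
  obtain ⟨ψ, rfl⟩ := Ext.mk₀_bijective _ _ |>.2 x₂
  refine ⟨ψ.hom, ?_⟩
  rw [Ext.mk₀_comp_mk₀] at hx₂
  have := (Ext.mk₀_bijective _ _).1 hx₂
  exact congrArg ModuleCat.Hom.hom this

lemma ext_subsingleton_right_quotient (hf : Function.Injective f) (h : Function.Exact f g)
    (hg : Function.Surjective g) {W : ModuleCat.{u} S} {n : ℕ}
    (hY : Subsingleton (Ext.{u} W Y n)) (hX : Subsingleton (Ext.{u} W X (n + 1))) :
    Subsingleton (Ext.{u} W Z n) := by
  refine subsingleton_of_forall_eq 0 fun x => ?_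
  obtain ⟨y, rfl⟩ := Ext.covariant_sequence_exact₃ W (shortExact_of_exact hf h hg) x rfl
    (Subsingleton.elim _ _)
  rw [Subsingleton.elim y 0, Ext.zero_comp]

lemma ext_subsingleton_right_sub (hf : Function.Injective f) (h : Function.Exact f g)
    (hg : Function.Surjective g) {W : ModuleCat.{u} S}
    (hY : Subsingleton (Ext.{u} W Y 1)) (hZ : ∀ φ : W →ₗ[S] Z, ∃ ψ : W →ₗ[S] Y, g ∘ₗ ψ = φ) :
    Subsingleton (Ext.{u} W X 1) := by
  refine subsingleton_of_forall_eq 0 fun x => ?_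
  obtain ⟨z, rfl⟩ := Ext.covariant_sequence_exact₁ W (shortExact_of_exact hf h hg) x
    (Subsingleton.elim _ _) (zero_add 1)
  obtain ⟨φ, rfl⟩ := Ext.mk₀_bijective _ _ |>.2 z
  obtain ⟨ψ, hψ⟩ := hZ φ.hom
  obtain rfl : ModuleCat.ofHom ψ ≫ (shortComplexOfExact f g h).g = φ := by
    ext x; exact LinearMap.congr_fun hψ x
  rw [← Ext.mk₀_comp_mk₀, Ext.comp_assoc_of_second_deg_zero, ShortComplex.ShortExact.comp_extClass,
    Ext.comp_zero]

lemma ext_subsingleton_left_sub (hf : Function.Injective f) (h : Function.Exact f g)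
    (hg : Function.Surjective g) {W : ModuleCat.{u} S} {n : ℕ}
    (hY : Subsingleton (Ext.{u} Y W n)) (hZ : Subsingleton (Ext.{u} Z W (n + 1))) :
    Subsingleton (Ext.{u} X W n) := by
  refine subsingleton_of_forall_eq 0 fun x => ?_
  obtain ⟨y, rfl⟩ := Ext.contravariant_sequence_exact₁ (shortExact_of_exact hf h hg) W x
    (add_comm 1 n) (Subsingleton.elim _ _)
  rw [Subsingleton.elim y 0, Ext.comp_zero]

end ShortExact

lemma ext_subsingleton_of_projective {P : ModuleCat.{u} S} (hP : Module.Projective S P)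
    (W : ModuleCat.{u} S) (n : ℕ) : Subsingleton (Ext.{u} P W (n + 1)) := by
  have : Projective P := (IsProjective.iff_projective P).1 hP
  exact Ext.subsingleton_of_projective P W n

lemma ext_subsingleton_of_injective {I : ModuleCat.{u} S} (hI : Module.Injective S I)
    (W : ModuleCat.{u} S) (n : ℕ) : Subsingleton (Ext.{u} W I (n + 1)) := by
  have : Injective I := (Module.injective_iff_injective_object S I).1 hI
  exact Ext.subsingleton_of_injective W I n

section Sums

variable {ι : Type*} [Fintype ι] {X W : ModuleCat.{u} S} {T : ι → ModuleCat.{u} S}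

lemma sum_ofHom_comp (i : ∀ j, X →ₗ[S] T j) (p : ∀ j, T j →ₗ[S] X)
    (h : ∑ j, p j ∘ₗ i j = LinearMap.id) :
    ∑ j, ModuleCat.ofHom (i j) ≫ ModuleCat.ofHom (p j) = 𝟙 X := by
  ext x
  have := LinearMap.congr_fun h x
  simpa [ModuleCat.hom_sum] using this

/-- Every Ext class out of `X` is its product with `id = ∑ p j ∘ i j`, each term of which passes
through some `T j`. This form of the hypothesis treats direct summands and finite direct sums at
once. -/
lemma ext_subsingleton_left_of_sum (i : ∀ j, X →ₗ[S] T j) (p : ∀ j, T j →ₗ[S] X)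
    (h : ∑ j, p j ∘ₗ i j = LinearMap.id) {n : ℕ} (hT : ∀ j, Subsingleton (Ext.{u} (T j) W n)) :
    Subsingleton (Ext.{u} X W n) := by
  refine subsingleton_of_forall_eq 0 fun x => ?_
  rw [← x.mk₀_id_comp, ← sum_ofHom_comp i p h, Ext.mk₀_sum, Ext.sum_comp]
  refine Finset.sum_eq_zero fun j _ => ?_
  rw [← Ext.mk₀_comp_mk₀, Ext.comp_assoc_of_second_deg_zero,
    Subsingleton.elim ((Ext.mk₀ (ModuleCat.ofHom (p j))).comp x (zero_add n)) 0, Ext.comp_zero]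

lemma ext_subsingleton_right_of_sum (i : ∀ j, X →ₗ[S] T j) (p : ∀ j, T j →ₗ[S] X)
    (h : ∑ j, p j ∘ₗ i j = LinearMap.id) {n : ℕ} (hT : ∀ j, Subsingleton (Ext.{u} W (T j) n)) :
    Subsingleton (Ext.{u} W X n) := by
  refine subsingleton_of_forall_eq 0 fun x => ?_
  rw [← x.comp_mk₀_id, ← sum_ofHom_comp i p h, Ext.mk₀_sum, Ext.comp_sum]
  refine Finset.sum_eq_zero fun j _ => ?_
  rw [← Ext.mk₀_comp_mk₀, ← Ext.comp_assoc_of_second_deg_zero,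
    Subsingleton.elim (x.comp (Ext.mk₀ (ModuleCat.ofHom (i j))) (add_zero n)) 0, Ext.zero_comp]

end Sums

lemma inAdd_of_sum {T X : ModuleCat.{u} S} {ι : Type*} [Fintype ι] (i : ι → X →ₗ[S] T)
    (p : ι → T →ₗ[S] X) (h : ∑ j, p j ∘ₗ i j = LinearMap.id) : InAdd T X := by
  let e := Fintype.equivFin ι
  refine ⟨Fintype.card ι, LinearMap.pi fun j => i (e.symm j),
    ∑ j, p (e.symm j) ∘ₗ LinearMap.proj j, ?_⟩
  rw [← h, ← e.symm.sum_comp]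
  ext x
  simp

lemma InAdd.exists_sum {T X : ModuleCat.{u} S} (h : InAdd T X) :
    ∃ (n : ℕ) (i : Fin n → X →ₗ[S] T) (p : Fin n → T →ₗ[S] X),
      ∑ j, p j ∘ₗ i j = LinearMap.id := by
  obtain ⟨n, i, p, h⟩ := h
  refine ⟨n, fun j => LinearMap.proj j ∘ₗ i, fun j => p ∘ₗ LinearMap.single S (fun _ => T) j, ?_⟩
  rw [← h]
  ext x
  simp only [LinearMap.coe_sum, LinearMap.coe_comp, Finset.sum_apply, Function.comp_apply,
    LinearMap.proj_apply, LinearMap.coe_single, ← map_sum]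
  congr 1
  exact Finset.univ_sum_single (i x)

lemma InAdd.refl (T : ModuleCat.{u} S) : InAdd T T :=
  inAdd_of_sum (ι := Unit) (fun _ => LinearMap.id) (fun _ => LinearMap.id) (by simp)

/-- `add T` is closed under direct summands of finite sums of its objects. -/
lemma InAdd.of_sum {T X : ModuleCat.{u} S} {ι : Type*} [Fintype ι] {Y : ι → ModuleCat.{u} S}
    (hY : ∀ j, InAdd T (Y j)) (i : ∀ j, X →ₗ[S] Y j)
    (p : ∀ j, Y j →ₗ[S] X) (h : ∑ j, p j ∘ₗ i j = LinearMap.id) : InAdd T X := by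
  choose n a b hab using fun j => (hY j).exists_sum
  refine inAdd_of_sum (ι := Σ j, Fin (n j)) (fun s => a s.1 s.2 ∘ₗ i s.1)
    (fun s => p s.1 ∘ₗ b s.1 s.2) ?_
  rw [← h, Fintype.sum_sigma]
  refine Finset.sum_congr rfl fun j _ => ?_
  have : p j ∘ₗ (∑ k, b j k ∘ₗ a j k) ∘ₗ i j = p j ∘ₗ i j := by rw [hab]; rfl
  rw [← this]
  ext x
  simp

lemma InAdd.retract {T X Y : ModuleCat.{u} S} (hY : InAdd T Y) (i : X →ₗ[S] Y) (p : Y →ₗ[S] X)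
    (h : p ∘ₗ i = LinearMap.id) : InAdd T X :=
  InAdd.of_sum (ι := Unit) (Y := fun _ => Y) (fun _ => hY) (fun _ => i) (fun _ => p) (by simpa)

lemma InAdd.pi {T : ModuleCat.{u} S} {ι : Type} [Fintype ι] {Y : ι → ModuleCat.{u} S}
    (hY : ∀ j, InAdd T (Y j)) : InAdd T (ModuleCat.of S (∀ j, Y j)) := by
  classical
  refine InAdd.of_sum hY (fun j => LinearMap.proj j)
    (fun j => LinearMap.single S (fun j => Y j) j) ?_
  refine LinearMap.ext fun x => ?_
  simpa using Finset.univ_sum_single x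

lemma InAdd.trans {T Y X : ModuleCat.{u} S} (hY : InAdd T Y) (hX : InAdd Y X) : InAdd T X := by
  obtain ⟨n, i, p, h⟩ := hX.exists_sum
  exact InAdd.of_sum (fun _ => hY) i p h

lemma InAdd.ext_left {T X W : ModuleCat.{u} S} (hX : InAdd T X) {n : ℕ}
    (h : Subsingleton (Ext.{u} T W n)) : Subsingleton (Ext.{u} X W n) := by
  obtain ⟨_, i, p, hip⟩ := hX.exists_sum
  exact ext_subsingleton_left_of_sum i p hip fun _ => h

lemma InAdd.ext_right {T X W : ModuleCat.{u} S} (hX : InAdd T X) {n : ℕ}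
    (h : Subsingleton (Ext.{u} W T n)) : Subsingleton (Ext.{u} W X n) := by
  obtain ⟨_, i, p, hip⟩ := hX.exists_sum
  exact ext_subsingleton_right_of_sum i p hip fun _ => h

lemma InAdd.inGen {T X : ModuleCat.{u} S} (h : InAdd T X) : InGen T X := by
  obtain ⟨n, i, p, h⟩ := h
  exact ⟨n, p, fun x => ⟨i x, LinearMap.congr_fun h x⟩⟩

lemma InAdd.inCogen {T X : ModuleCat.{u} S} (h : InAdd T X) : InCogen T X := by
  obtain ⟨n, i, p, h⟩ := h
  exact ⟨n, i, Function.LeftInverse.injective (LinearMap.congr_fun h)⟩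

lemma InGen.of_surjective {T X Y : ModuleCat.{u} S} (h : InGen T X) (f : X →ₗ[S] Y)
    (hf : Function.Surjective f) : InGen T Y := by
  obtain ⟨m, g, hg⟩ := h
  exact ⟨m, f ∘ₗ g, hf.comp hg⟩

lemma InCogen.of_injective {T X Y : ModuleCat.{u} S} (h : InCogen T X) (f : Y →ₗ[S] X)
    (hf : Function.Injective f) : InCogen T Y := by
  obtain ⟨m, g, hg⟩ := h
  exact ⟨m, g ∘ₗ f, hg.comp hf⟩

lemma InGen.pi {T Y : ModuleCat.{u} S} (h : InGen T Y) (n : ℕ) :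
    InGen T (ModuleCat.of S (Fin n → Y)) := by
  obtain ⟨m, g, hg⟩ := h
  refine InGen.of_surjective (X := ModuleCat.of S (Fin n → (Fin m → T)))
    (InAdd.pi (Y := fun _ => ModuleCat.of S (Fin m → T)) fun _ =>
      InAdd.pi fun _ => InAdd.refl T).inGen
    (LinearMap.pi fun j => g ∘ₗ LinearMap.proj j) ?_
  intro y
  choose x hx using fun j => hg (y j)
  exact ⟨x, funext hx⟩

lemma InCogen.pi {T Y : ModuleCat.{u} S} (h : InCogen T Y) (n : ℕ) :
    InCogen T (ModuleCat.of S (Fin n → Y)) := by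
  obtain ⟨m, g, hg⟩ := h
  refine InCogen.of_injective (X := ModuleCat.of S (Fin n → (Fin m → T)))
    (InAdd.pi (Y := fun _ => ModuleCat.of S (Fin m → T)) fun _ =>
      InAdd.pi fun _ => InAdd.refl T).inCogen
    (LinearMap.pi fun j => g ∘ₗ LinearMap.proj j) ?_
  intro x y hxy
  exact funext fun j => hg (congrFun hxy j)

lemma InGen.trans {T Y X : ModuleCat.{u} S} (hY : InGen T Y) (hX : InGen Y X) : InGen T X := by
  obtain ⟨m, f, hf⟩ := hX
  exact InGen.of_surjective (hY.pi m) f hf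

lemma InCogen.trans {T Y X : ModuleCat.{u} S} (hY : InCogen T Y) (hX : InCogen Y X) :
    InCogen T X := by
  obtain ⟨m, f, hf⟩ := hX
  exact InCogen.of_injective (hY.pi m) f hf

/-- An injective module cogenerated by `T` lies in `add T`. -/
lemma InCogen.inAdd_of_injective {T X : ModuleCat.{u} S} (h : InCogen T X)
    (hX : Module.Injective S X) : InAdd T X := by
  obtain ⟨m, f, hf⟩ := h
  obtain ⟨g, hg⟩ := hX.out (X := X) (Y := Fin m → T) f hf LinearMap.id
  exact ⟨m, f, g, LinearMap.ext hg⟩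

lemma InAdd.projective {T X : ModuleCat.{u} S} (h : InAdd T X) (hT : Module.Projective S T) :
    Module.Projective S X := by
  rw [IsProjective.iff_projective, projective_iff_subsingleton_ext_one]
  exact fun Y => h.ext_left (ext_subsingleton_of_projective hT Y 0)

lemma InAdd.injective {T X : ModuleCat.{u} S} (h : InAdd T X) (hT : Module.Injective S T) :
    Module.Injective S X := by
  rw [Module.injective_iff_injective_object, injective_iff_subsingleton_ext_one]
  exact fun Y => h.ext_right (ext_subsingleton_of_injective hT Y 0)

lemma InAdd.finite {T X : ModuleCat.{u} S} (h : InAdd T X) (hT : Module.Finite S T) :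
    Module.Finite S X := by
  obtain ⟨m, f, hf⟩ := h.inGen
  exact Module.Finite.of_surjective f hf

end HomologicalTools

/-! ### Left and right approximations by add T. -/

section Approximations

/-- The module `Hom_Λ(T, M)` is finitely generated over `R`. -/
lemma exists_hom_generators (R : Type u) [CommRing R] [IsNoetherianRing R] {Λ : Type u} [Ring Λ]
    [Algebra R Λ] [Module.Finite R Λ]
    (T M : ModuleCat.{u} Λ) (hT : Module.Finite Λ T)
    (hM : Module.Finite Λ M) :
    ∃ (m : ℕ) (φ : Fin m → T →ₗ[Λ] M), ∀ ψ : T →ₗ[Λ] M, ∃ c : Fin m → R,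
      ∀ t, ψ t = ∑ j, algebraMap R Λ (c j) • φ j t := by
  let : Module R T := Module.compHom T (algebraMap R Λ)
  let : Module R M := Module.compHom M (algebraMap R Λ)
  have : IsScalarTower R Λ T := ⟨fun r l t => by
    rw [Algebra.smul_def, mul_smul]; rfl⟩
  have : IsScalarTower R Λ M := ⟨fun r l t => by
    rw [Algebra.smul_def, mul_smul]; rfl⟩
  have : SMulCommClass Λ R M := ⟨fun l r t => by
    change l • (algebraMap R Λ r • t) = algebraMap R Λ r • l • t
    rw [smul_smul, smul_smul, Algebra.commutes]⟩
  have : Module.Finite R T := Module.Finite.trans Λ T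
  have : Module.Finite R M := Module.Finite.trans Λ M
  have : Module.Finite R (T →ₗ[Λ] M) :=
    Module.Finite.of_injective (LinearMap.restrictScalarsₗ R Λ T M R)
      (LinearMap.restrictScalars_injective R)
  obtain ⟨m, φ, hφ⟩ := Module.Finite.exists_fin (R := R) (M := T →ₗ[Λ] M)
  refine ⟨m, φ, fun ψ => ?_⟩
  obtain ⟨c, rfl⟩ := (Submodule.mem_span_range_iff_exists_fun R).1 (hφ ▸ Submodule.mem_top (x := ψ))
  refine ⟨c, fun t => ?_⟩
  rw [LinearMap.sum_apply]
  rfl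

/-- Multiplication by a scalar of the ground ring, as a linear map. -/
def centralSMul {R : Type u} [CommRing R] {Λ : Type u} [Ring Λ] [Algebra R Λ] (c : R)
    (T : ModuleCat.{u} Λ) : T →ₗ[Λ] T where
  toFun t := algebraMap R Λ c • t
  map_add' := smul_add _
  map_smul' l t := by
    simp only [smul_smul, RingHom.id_apply, Algebra.commutes]

/-- Right `add T`-approximations exist. -/
lemma exists_right_approximation (R : Type u) [CommRing R] [IsNoetherianRing R] {Λ : Type u} [Ring Λ]
    [Algebra R Λ] [Module.Finite R Λ]
    (T M : ModuleCat.{u} Λ) (hT : Module.Finite Λ T)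
    (hM : Module.Finite Λ M) :
    ∃ (m : ℕ) (p : (Fin m → T) →ₗ[Λ] M), ∀ X : ModuleCat.{u} Λ, InAdd T X →
      ∀ ψ : X →ₗ[Λ] M, ∃ χ : X →ₗ[Λ] (Fin m → T), p ∘ₗ χ = ψ := by
  obtain ⟨m, φ, hφ⟩ := exists_hom_generators R T M hT hM
  refine ⟨m, ∑ j, φ j ∘ₗ LinearMap.proj j, fun X hX ψ => ?_⟩
  obtain ⟨n, i, q, hiq⟩ := hX.exists_sum
  choose c hc using fun k => hφ (ψ ∘ₗ q k)
  refine ⟨∑ k, (LinearMap.pi fun j => centralSMul (c k j) T) ∘ₗ i k, ?_⟩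
  have h : ψ = ∑ k, (ψ ∘ₗ q k) ∘ₗ i k := by
    conv_lhs => rw [← LinearMap.comp_id ψ, ← hiq]
    ext x
    simp
  rw [h]
  refine LinearMap.ext fun x => ?_
  simp only [LinearMap.comp_apply, LinearMap.sum_apply, map_sum, LinearMap.proj_apply,
    LinearMap.pi_apply]
  refine Finset.sum_congr rfl fun k _ => ?_
  rw [show ψ (q k (i k x)) = _ from hc k (i k x)]
  refine Finset.sum_congr rfl fun j _ => ?_
  exact map_smul (φ j) _ _

/-- Left `add Q`-approximations exist. -/
lemma exists_left_approximation (R : Type u) [CommRing R] [IsNoetherianRing R] {Λ : Type u} [Ring Λ]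
    [Algebra R Λ] [Module.Finite R Λ]
    (Q M : ModuleCat.{u} Λ) (hQ : Module.Finite Λ Q)
    (hM : Module.Finite Λ M) :
    ∃ (m : ℕ) (f : M →ₗ[Λ] (Fin m → Q)),
      ∀ (n : ℕ) (ψ : M →ₗ[Λ] (Fin n → Q)), ∃ χ : (Fin m → Q) →ₗ[Λ] (Fin n → Q), χ ∘ₗ f = ψ := by
  obtain ⟨m, φ, hφ⟩ := exists_hom_generators R M Q hM hQ
  refine ⟨m, LinearMap.pi φ, fun n ψ => ?_⟩
  choose c hc using fun k => hφ (LinearMap.proj k ∘ₗ ψ)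
  refine ⟨LinearMap.pi fun k => ∑ j, centralSMul (c k j) Q ∘ₗ LinearMap.proj j, ?_⟩
  refine LinearMap.ext fun x => funext fun k => ?_
  rw [LinearMap.comp_apply, LinearMap.pi_apply, LinearMap.sum_apply]
  exact (hc k x).symm

/-- A right approximation absorbs the image of every map from `add T`, so it is onto as soon as
these images cover `N`. -/
lemma inGen_of_forall_exists (R : Type u) [CommRing R] [IsNoetherianRing R] {Λ : Type u} [Ring Λ]
    [Algebra R Λ] [Module.Finite R Λ]
    {T N : ModuleCat.{u} Λ} (hT : Module.Finite Λ T)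
    (hN : Module.Finite Λ N)
    (h : ∀ x : N, ∃ (X : ModuleCat.{u} Λ) (φ : X →ₗ[Λ] N), InAdd T X ∧ x ∈ LinearMap.range φ) :
    InGen T N := by
  obtain ⟨m, p, hp⟩ := exists_right_approximation R T N hT hN
  refine ⟨m, p, fun x => ?_⟩
  obtain ⟨X, φ, hX, y, rfl⟩ := h x
  obtain ⟨χ, rfl⟩ := hp X hX φ
  exact ⟨χ y, rfl⟩

/-- If `T` satisfies `Ext¹(T, T) = 0` and the coresolution condition of a tilting module, then
every finitely generated module generated by `T` has a right `add T`-approximation whose kernel is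
again generated by `T` and satisfies `Ext¹(T, -) = 0`. -/
lemma exists_approximation_of_inGen (R : Type u) [CommRing R] [IsNoetherianRing R] {Λ : Type u} [Ring Λ]
    [Algebra R Λ] [Module.Finite R Λ]
    {T M : ModuleCat.{u} Λ} (hT : Module.Finite Λ T)
    (hM : Module.Finite Λ M) (hTM : InGen T M) (hext : Subsingleton (Ext.{u} T T 1))
    {T₀ T₁ : ModuleCat.{u} Λ} (h₀ : InAdd T T₀) (h₁ : InAdd T T₁) (f : Λ →ₗ[Λ] T₀)
    (g : T₀ →ₗ[Λ] T₁) (hf : Function.Injective f) (hfg : Function.Exact f g)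
    (hg : Function.Surjective g) :
    ∃ (m : ℕ) (p : (Fin m → T) →ₗ[Λ] M), Function.Surjective p ∧
      InGen T (ModuleCat.of Λ (LinearMap.ker p)) ∧
      Subsingleton (Ext.{u} T (ModuleCat.of Λ (LinearMap.ker p)) 1) := by
  obtain ⟨m, p, hp⟩ := exists_right_approximation R T M hT hM
  have : IsNoetherianRing Λ := IsNoetherianRing.of_finite R Λ
  have hTm : InAdd T (ModuleCat.of Λ (Fin m → T)) := InAdd.pi fun _ => InAdd.refl T
  have hsurj : Function.Surjective p := by
    obtain ⟨k, q, hq⟩ := hTM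
    obtain ⟨χ, rfl⟩ := hp (ModuleCat.of Λ (Fin k → T)) (InAdd.pi fun _ => InAdd.refl T) q
    exact Function.Surjective.of_comp (g := χ) hq
  refine ⟨m, p, hsurj, ?_, ?_⟩
  · refine inGen_of_forall_exists R hT inferInstance ?_
    intro x
    -- Since `Ext¹(T₁, T^m) = 0`, the map `Λ → T^m` sending `1` to `x` extends along `f` to `a : T₀
    -- → T^m`.
    obtain ⟨a, ha⟩ := exists_extension_of_ext_one (X := ModuleCat.of Λ Λ) hf hfg hg
      (W := ModuleCat.of Λ (Fin m → T)) (hTm.ext_right (h₁.ext_left hext))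
      ((LinearMap.ker p).subtype ∘ₗ LinearMap.toSpanSingleton Λ _ x)
    have hker : LinearMap.ker g ≤ LinearMap.ker (p ∘ₗ a) := by
      intro y hy
      obtain ⟨l, rfl⟩ := (hfg y).1 hy
      have : a (f l) = _ := LinearMap.congr_fun ha l
      rw [LinearMap.mem_ker, LinearMap.comp_apply, this]
      exact (LinearMap.toSpanSingleton Λ _ x l).2
    -- As `x` lies in `ker p`, the map `p ∘ a` vanishes on `Λ` and descends to `T₁`. Lifting the
    -- result through the approximation gives a correction that does not change the value at `f 1`.
    obtain ⟨b, hb⟩ : ∃ b : T₁ →ₗ[Λ] M, b ∘ₗ g = p ∘ₗ a := by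
      refine ⟨(LinearMap.ker g).liftQ (p ∘ₗ a) hker ∘ₗ
        (g.quotKerEquivOfSurjective hg).symm.toLinearMap, LinearMap.ext fun y => ?_⟩
      have : (g.quotKerEquivOfSurjective hg).symm (g y) = Submodule.Quotient.mk y := by
        rw [LinearEquiv.symm_apply_eq]; rfl
      simp only [LinearMap.comp_apply, LinearEquiv.coe_coe, this]
      rfl
    obtain ⟨χ, rfl⟩ := hp T₁ h₁ b
    refine ⟨T₀, LinearMap.codRestrict (LinearMap.ker p) (a - χ ∘ₗ g) fun y => ?_, h₀, f 1, ?_⟩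
    · have := LinearMap.congr_fun hb y
      simp only [LinearMap.comp_apply] at this
      simp [this]
    · apply Subtype.ext
      have h1 : a (f 1) = _ := LinearMap.congr_fun ha 1
      have h2 : g (f 1) = 0 := (hfg _).2 ⟨1, rfl⟩
      simp [h1, h2]
  · refine ext_subsingleton_right_sub (Y := ModuleCat.of Λ (Fin m → T)) (Z := M)
      (f := (LinearMap.ker p).subtype) (g := p) Subtype.val_injective
      (LinearMap.exact_subtype_ker_map p) hsurj (hTm.ext_right hext) ?_
    exact hp T (InAdd.refl T)

end Approximations

/-! ### Injective envelopes and minimal injective resolutions. -/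

section Envelopes

variable {S : Type u} [Ring S]

/-- Injective envelopes exist. -/
theorem exists_isInjectiveEnvelope (M : ModuleCat.{u} S) :
    ∃ (E : ModuleCat.{u} S) (f : M →ₗ[S] E), IsInjectiveEnvelope f := by
  obtain ⟨⟨I, hI, ι, hι⟩⟩ := EnoughInjectives.presentation M
  have hI' : Module.Injective S I := (Module.injective_iff_injective_object S I).2 hI
  have hι' : Function.Injective ι.hom := (ModuleCat.mono_iff_injective ι).1 hι
  let A : Submodule S I := LinearMap.range ι.hom
  let s : Set (Submodule S I) := {N | A ≤ N ∧ ∀ x ∈ N, x ≠ 0 → ∃ r : S, r • x ∈ A ∧ r • x ≠ 0}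
  -- `N` is a maximal essential extension of `A` inside `I`, and `C` below is maximal among
  -- submodules meeting `N` trivially. Then `N → I ⧸ C` is again essential.
  obtain ⟨N, -, hN⟩ := zorn_le_nonempty₀ s (by
    intro c hc hchain y hy
    refine ⟨sSup c, ⟨(hc hy).1.trans (le_sSup hy), fun x hx hx0 => ?_⟩, fun z hz => le_sSup hz⟩
    obtain ⟨z, hz, hxz⟩ := (Submodule.mem_sSup_of_directed ⟨y, hy⟩ hchain.directedOn).1 hx
    exact (hc hz).2 x hxz hx0) A ⟨le_rfl, fun x hx hx0 => ⟨1, by simpa, by simpa⟩⟩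
  obtain ⟨C, -, hC⟩ := zorn_le_nonempty₀ {C : Submodule S I | ∀ x ∈ C, x ∈ N → x = 0} (by
    intro c hc hchain y hy
    refine ⟨sSup c, fun x hx hxN => ?_, fun z hz => le_sSup hz⟩
    obtain ⟨z, hz, hxz⟩ := (Submodule.mem_sSup_of_directed ⟨y, hy⟩ hchain.directedOn).1 hx
    exact hc hz x hxz hxN) ⊥ (by simp)
  let q : N →ₗ[S] I ⧸ C := C.mkQ ∘ₗ N.subtype
  have hq : Function.Injective q := by
    rw [← LinearMap.ker_eq_bot, LinearMap.ker_eq_bot']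
    intro n hn
    exact Subtype.ext (hC.1 n ((Submodule.Quotient.mk_eq_zero C).1 hn) n.2)
  have hess : ∀ d : I ⧸ C, d ≠ 0 → ∃ (r : S) (n : N), n ≠ 0 ∧ q n = r • d := by
    intro d hd
    obtain ⟨x, rfl⟩ := Submodule.Quotient.mk_surjective C d
    by_contra! hcon
    have hmem : C ⊔ Submodule.span S {x} ∈ {C : Submodule S I | ∀ x ∈ C, x ∈ N → x = 0} := by
      intro z hz hzN
      obtain ⟨c, hc, y, hy, rfl⟩ := Submodule.mem_sup.1 hz
      obtain ⟨r, rfl⟩ := Submodule.mem_span_singleton.1 hy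
      by_contra h0
      refine hcon r ⟨_, hzN⟩ (fun h => h0 (congrArg Subtype.val h)) ?_
      change Submodule.Quotient.mk (c + r • x) = _
      rw [Submodule.Quotient.mk_add, (Submodule.Quotient.mk_eq_zero C).2 hc, zero_add,
        Submodule.Quotient.mk_smul]
    have : x ∈ C := hC.2 hmem le_sup_left
      (Submodule.mem_sup_right (Submodule.mem_span_singleton_self x))
    exact hd ((Submodule.Quotient.mk_eq_zero C).2 this)
  obtain ⟨g, hg⟩ := hI'.out q hq N.subtype
  have hginj : Function.Injective g := by
    rw [← LinearMap.ker_eq_bot, LinearMap.ker_eq_bot']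
    intro d hd
    by_contra h0
    obtain ⟨r, n, hn, hnd⟩ := hess d h0
    have := hg n
    rw [hnd, map_smul, hd, smul_zero] at this
    exact hn (Subtype.ext this.symm)
  -- The image of `g` is an essential extension of `A` containing `N`, so maximality gives equality.
  -- Thus `N` is a retract of the injective module `I`.
  have hrange : LinearMap.range g ≤ N := by
    refine hN.2 ⟨fun x hx => ?_, ?_⟩ fun x hx => ?_
    · exact ⟨q ⟨x, hN.1.1 hx⟩, hg _⟩
    · rintro _ ⟨d, rfl⟩ h0
      obtain ⟨r, n, hn, hnd⟩ := hess d (fun h => h0 (by rw [h, map_zero]))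
      obtain ⟨r', h1, h2⟩ := hN.1.2 n n.2 (fun h => hn (Subtype.ext h))
      have : r • g d = n := by rw [← map_smul, ← hnd]; exact hg n
      exact ⟨r' * r, by rwa [mul_smul, this], by rwa [mul_smul, this]⟩
    · exact ⟨q ⟨x, hx⟩, hg _⟩
  have hNinj : Module.Injective S N := by
    refine InAdd.injective (X := ModuleCat.of S N) (((InAdd.refl I).retract N.subtype
      (LinearMap.codRestrict N (g ∘ₗ C.mkQ) fun x => hrange ⟨_, rfl⟩) ?_)) hI'
    exact LinearMap.ext fun n => Subtype.ext (hg n)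
  refine ⟨ModuleCat.of S N, LinearMap.codRestrict N ι.hom fun x => hN.1.1 ⟨x, rfl⟩, ?_, hNinj, ?_⟩
  · exact fun x y h => hι' (congrArg Subtype.val h)
  · intro D hD
    rw [Submodule.eq_bot_iff]
    intro x hx
    by_contra h0
    obtain ⟨r, ⟨m, hm⟩, h2⟩ := hN.1.2 x x.2 (fun h => h0 (Subtype.ext h))
    refine h2 ?_
    have : r • x ∈ D ⊓ LinearMap.range (LinearMap.codRestrict N ι.hom fun x => hN.1.1 ⟨x, rfl⟩) :=
      ⟨D.smul_mem r hx, m, Subtype.ext hm⟩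
    rw [hD, Submodule.mem_bot] at this
    exact congrArg Subtype.val this

/-- The cokernels in a minimal injective resolution. -/
noncomputable def cosyzygy (M : ModuleCat.{u} S) : ℕ → ModuleCat.{u} S
  | 0 => M
  | n + 1 => ModuleCat.of S ((exists_isInjectiveEnvelope (cosyzygy M n)).choose ⧸
      LinearMap.range (exists_isInjectiveEnvelope (cosyzygy M n)).choose_spec.choose)

theorem nonempty_minimalInjectiveResolution (M : ModuleCat.{u} S) :
    Nonempty (MinimalInjectiveResolution M) := by
  let E (n : ℕ) : ModuleCat.{u} S := (exists_isInjectiveEnvelope (cosyzygy M n)).choose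
  let f (n : ℕ) : cosyzygy M n →ₗ[S] E n :=
    (exists_isInjectiveEnvelope (cosyzygy M n)).choose_spec.choose
  have hf (n : ℕ) : IsInjectiveEnvelope (f n) :=
    (exists_isInjectiveEnvelope (cosyzygy M n)).choose_spec.choose_spec
  let π (n : ℕ) : E n →ₗ[S] cosyzygy M (n + 1) := (LinearMap.range (f n)).mkQ
  have hπ (n : ℕ) : Function.Surjective (π n) := Submodule.mkQ_surjective _
  have hfπ (n : ℕ) : Function.Exact (f n) (π n) := LinearMap.exact_map_mkQ_range _
  have hex (n : ℕ) : Function.Exact (f n) (f (n + 1) ∘ₗ π n) := fun y => by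
    rw [LinearMap.comp_apply, ← hfπ n y]
    exact map_eq_zero_iff _ (hf (n + 1)).injective
  have hrange (n : ℕ) : LinearMap.range (f (n + 1) ∘ₗ π n) = LinearMap.range (f (n + 1)) :=
    LinearMap.range_comp_of_range_eq_top _ (LinearMap.range_eq_top.2 (hπ n))
  refine ⟨⟨E, f 0, fun n => f (n + 1) ∘ₗ π n, fun n => (hf n).injective_module, (hf 0).injective,
    hex 0, fun n => ?_, (hf 0).essential, fun n => ?_⟩⟩
  · intro x
    rw [hex (n + 1) x]
    exact Set.ext_iff.1 (congrArg (fun N : Submodule S (E (n + 1)) => (N : Set (E (n + 1))))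
      (hrange n)).symm x
  · rw [hrange n]
    exact (hf (n + 1)).essential

/-- An essential extension of a module cogenerated by the injective module `W` is cogenerated by
`W`. -/
lemma inCogen_of_essential {E W : ModuleCat.{u} S} (hW : Module.Injective S W)
    (A : Submodule S E) (hA : ∀ N : Submodule S E, N ⊓ A = ⊥ → N = ⊥)
    (h : InCogen W (ModuleCat.of S A)) : InCogen W E := by
  obtain ⟨m, f, hf⟩ := h
  have : Module.Injective S (Fin m → W) := (InAdd.pi fun _ => InAdd.refl W).injective hW
  obtain ⟨g, hg⟩ := this.out A.subtype A.injective_subtype f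
  -- The extension `g` agrees with the injective map `f` on `A`, so its kernel meets `A` trivially
  -- and vanishes by essentiality.
  refine ⟨m, g, LinearMap.ker_eq_bot.1 (hA _ ?_)⟩
  rw [Submodule.eq_bot_iff]
  rintro x ⟨hx, hxA⟩
  have h0 : f ⟨x, hxA⟩ = f 0 := by rw [← hg, map_zero]; exact hx
  exact congrArg Subtype.val (hf h0)

end Envelopes

/-! ### The module DΛ is a finitely generated injective cogenerator. -/

section Duality

/-- Induction on a composition series, using left exactness of `Hom(-, J)`. On a simple module,
evaluation at a nonzero `x` embeds the dual in `A`: if `φ x ≠ 0`, some nonzero multiple `r • φ x`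
lies in `A` by essentiality, and `x` is in turn a multiple of `r • x`. -/
lemma finite_dual_of_isFiniteLength {R : Type u} [CommRing R] [IsArtinianRing R]
    {J : Type u} [AddCommGroup J] [Module R J] (A : Submodule R J) [Module.Finite R A]
    (hA : ∀ N : Submodule R J, N ⊓ A = ⊥ → N = ⊥) (M : Type u) [AddCommGroup M] [Module R M]
    (hM : IsFiniteLength R M) : IsNoetherian R (M →ₗ[R] J) := by
  induction hM with
  | of_subsingleton => infer_instance
  | @of_simple_quotient M _ _ N hN _ ih =>
    have : IsNoetherian R ((M ⧸ N) →ₗ[R] J) := by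
      have := IsSimpleModule.nontrivial R (M ⧸ N)
      obtain ⟨x, hx⟩ := exists_ne (0 : M ⧸ N)
      let ev : ((M ⧸ N) →ₗ[R] J) →ₗ[R] J := LinearMap.applyₗ x
      have hx' (y : M ⧸ N) (hy : y ≠ 0) (z : M ⧸ N) : ∃ r : R, z = r • y := by
        obtain ⟨r, hr⟩ := IsSimpleModule.toSpanSingleton_surjective R hy z
        exact ⟨r, hr.symm⟩
      have hev : ∀ φ, ev φ ∈ A := by
        intro φ
        by_cases h0 : φ x = 0
        · change φ x ∈ A
          rw [h0]; exact A.zero_mem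
        have : Submodule.span R {φ x} ⊓ A ≠ ⊥ := fun h => h0 (by
          simpa using hA _ h)
        obtain ⟨y, ⟨hy, hyA⟩, hy0⟩ := Submodule.exists_mem_ne_zero_of_ne_bot this
        obtain ⟨r, rfl⟩ := Submodule.mem_span_singleton.1 hy
        obtain ⟨t, ht⟩ := hx' (r • x) (fun h => hy0 (by rw [← map_smul, h, map_zero])) x
        change φ x ∈ A
        rw [ht, map_smul, map_smul]
        exact A.smul_mem t hyA
      refine isNoetherian_of_injective (LinearMap.codRestrict A ev hev) ?_
      rw [← LinearMap.ker_eq_bot, LinearMap.ker_eq_bot']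
      intro φ hφ
      have hφ' : φ x = 0 := congrArg Subtype.val hφ
      ext : 1
      refine LinearMap.ext fun w => ?_
      obtain ⟨r, hr⟩ := hx' x hx (N.mkQ w)
      rw [LinearMap.comp_apply, hr, map_smul, hφ', smul_zero]
      rfl
    refine isNoetherian_of_range_eq_ker (M := (M ⧸ N) →ₗ[R] J) (P := N →ₗ[R] J)
      (LinearMap.lcomp R J N.mkQ) (LinearMap.lcomp R J N.subtype) ?_
    ext φ
    constructor
    · rintro ⟨ψ, rfl⟩
      ext y
      change ψ (N.mkQ y) = 0
      rw [N.mkQ_apply, (Submodule.Quotient.mk_eq_zero N).2 y.2, map_zero]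
    · intro hφ
      refine ⟨N.liftQ φ fun y hy => LinearMap.congr_fun hφ (⟨y, hy⟩ : N), ?_⟩
      ext y
      rfl

variable (R : Type u) [CommRing R] (Λ : Type u) [Ring Λ] [Algebra R Λ] (J : Type u)
  [AddCommGroup J] [Module R J]

/-- Coinduction: `Λ`-linear maps `X → Hom_R(Λ, J)` correspond to `R`-linear maps `X → J` through
evaluation at `1`, and the latter extend along injections. -/
lemma regularDual_injective (hJ : Module.Injective R J) :
    Module.Injective Λ (RegularDual R Λ J) where
  out X Y _ _ _ _ f hf g := by
    let : Module R X := Module.compHom X (algebraMap R Λ)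
    let : Module R Y := Module.compHom Y (algebraMap R Λ)
    let g₁ : X →ₗ[R] J :=
      { toFun x := (show Λ →ₗ[R] J from g x) 1
        map_add' x y := by rw [map_add]; rfl
        map_smul' r x := by
          change (show Λ →ₗ[R] J from g (algebraMap R Λ r • x)) 1 = _
          rw [map_smul]
          change (show Λ →ₗ[R] J from g x) (1 * algebraMap R Λ r) = _
          rw [one_mul, Algebra.algebraMap_eq_smul_one, map_smul]
          rfl }
    let f₁ : X →ₗ[R] Y :=
      { toFun := f
        map_add' := map_add f
        map_smul' r x := map_smul f (algebraMap R Λ r) x }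
    obtain ⟨h₁, hh₁⟩ := hJ.out f₁ hf g₁
    refine ⟨{ toFun y := (show Λ →ₗ[R] J from
                { toFun a := h₁ (a • y)
                  map_add' a b := by rw [add_smul, map_add]
                  map_smul' r a := by
                    rw [Algebra.smul_def, mul_smul]
                    exact map_smul h₁ r (a • y) })
              map_add' y z := LinearMap.ext fun a => ?_
              map_smul' b y := LinearMap.ext fun a => ?_ }, fun x => LinearMap.ext fun a => ?_⟩
    · change h₁ (a • (y + z)) = h₁ (a • y) + h₁ (a • z)
      rw [smul_add, map_add]
    · change h₁ (a • b • y) = h₁ ((a * b) • y)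
      rw [mul_smul]
    · change h₁ (a • f x) = (show Λ →ₗ[R] J from g x) a
      rw [← map_smul]
      refine (hh₁ (a • x)).trans ?_
      change (show Λ →ₗ[R] J from g (a • x)) 1 = _
      rw [map_smul]
      change (show Λ →ₗ[R] J from g x) (1 * a) = _
      rw [one_mul]

lemma regularDual_finite [IsArtinianRing R] [Module.Finite R Λ] (A : Submodule R J)
    [Module.Finite R A] (hA : ∀ N : Submodule R J, N ⊓ A = ⊥ → N = ⊥) :
    Module.Finite Λ (RegularDual R Λ J) := by
  have : IsArtinian R Λ := isArtinian_of_fg_of_artinian'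
  have h1 : IsNoetherian R (Λ →ₗ[R] J) := finite_dual_of_isFiniteLength A hA Λ
    (isFiniteLength_iff_isNoetherian_isArtinian.2 ⟨inferInstance, inferInstance⟩)
  have h2 : Module.Finite R (Λ →ₗ[R] J) := inferInstance
  obtain ⟨n, s, hs⟩ := Module.Finite.exists_fin (R := R) (M := Λ →ₗ[R] J)
  refine ⟨⟨(Set.finite_range s).toFinset, ?_⟩⟩
  rw [eq_top_iff]
  rintro φ -
  obtain ⟨c, hc⟩ := (Submodule.mem_span_range_iff_exists_fun R).1
    (hs ▸ Submodule.mem_top (x := (show Λ →ₗ[R] J from φ)))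
  have : φ = ∑ j, algebraMap R Λ (c j) • (show RegularDual R Λ J from s j) := by
    refine Eq.trans hc.symm (Finset.sum_congr rfl fun j _ => LinearMap.ext fun a => ?_)
    change c j • s j a = s j (a * algebraMap R Λ (c j))
    rw [← Algebra.commutes, ← Algebra.smul_def, map_smul]
  rw [this]
  refine Submodule.sum_mem _ fun j _ => Submodule.smul_mem _ _ (Submodule.subset_span ?_)
  exact (Set.Finite.mem_toFinset _).2 ⟨j, rfl⟩

/-- The cyclic module `R x` has a simple quotient `R ⧸ m`. As `R ⧸ rad R` is semisimple, it contains
a copy of `R ⧸ m`, so `R x` maps to `J` without killing `x`; injectivity of `J` extends this map to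
`M`. -/
lemma exists_apply_ne_zero_of_injectiveEnvelope [IsArtinianRing R]
    {J : ModuleCat.{u} R} {e : ModuleCat.of R (R ⧸ Ring.jacobson R) →ₗ[R] J}
    (he : IsInjectiveEnvelope e) (M : Type u) [AddCommGroup M] [Module R M] (x : M) (hx : x ≠ 0) :
    ∃ φ : M →ₗ[R] J, φ x ≠ 0 := by
  let a : Ideal R := LinearMap.ker (LinearMap.toSpanSingleton R M x)
  have ha : a ≠ ⊤ := fun h => hx (by
    have : (1 : R) ∈ a := h ▸ Submodule.mem_top
    simpa [a] using this)
  obtain ⟨m, hm, ham⟩ := Ideal.exists_le_maximal a ha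
  have hss : IsSemisimpleModule R (R ⧸ Ring.jacobson R) :=
    (IsArtinian.isSemisimpleModule_iff_jacobson R _).2 (Module.jacobson_quotient_jacobson R R)
  have hjm : Ring.jacobson R ≤ m := sInf_le hm.out
  obtain ⟨t, ht⟩ := IsSemisimpleModule.lifting_property
    (Submodule.liftQ (Ring.jacobson R) m.mkQ (by rwa [Submodule.ker_mkQ]))
    (fun y => by
      obtain ⟨r, rfl⟩ := Submodule.mkQ_surjective m y
      exact ⟨Submodule.Quotient.mk r, rfl⟩) (LinearMap.id)
  have htinj : Function.Injective t := Function.LeftInverse.injective (LinearMap.congr_fun ht)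
  obtain ⟨φ, hφ⟩ := he.injective_module.out
    (Submodule.liftQ a (LinearMap.toSpanSingleton R M x) le_rfl)
    (LinearMap.ker_eq_bot.1 (Submodule.ker_liftQ_eq_bot _ _ _ le_rfl))
    (e ∘ₗ t ∘ₗ a.liftQ m.mkQ (by rwa [Submodule.ker_mkQ]))
  refine ⟨φ, fun h0 => ?_⟩
  have h1 := hφ (Submodule.Quotient.mk 1)
  have h2 : Submodule.liftQ a (LinearMap.toSpanSingleton R M x) le_rfl (Submodule.Quotient.mk 1)
    = x := one_smul R x
  rw [h2, h0] at h1
  have h3 : m.mkQ 1 = 0 := htinj (he.injective (by rw [map_zero, map_zero]; exact h1.symm))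
  exact hm.ne_top ((Ideal.eq_top_iff_one m).2 ((Submodule.Quotient.mk_eq_zero m).1 h3))

/-- Maps `M → DΛ` separate points, and all of them factor through one left approximation into a
finite power, which is therefore injective. -/
lemma inCogen_regularDual [IsArtinianRing R] [Module.Finite R Λ]
    {J : ModuleCat.{u} R} {e : ModuleCat.of R (R ⧸ Ring.jacobson R) →ₗ[R] J}
    (he : IsInjectiveEnvelope e) (hD : Module.Finite Λ (RegularDual R Λ J))
    (M : ModuleCat.{u} Λ) (hM : Module.Finite Λ M) :
    InCogen (ModuleCat.of Λ (RegularDual R Λ J)) M := by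
  obtain ⟨m, f, hf⟩ :=
    exists_left_approximation R (ModuleCat.of Λ (RegularDual R Λ J)) M hD hM
  refine ⟨m, f, ?_⟩
  rw [← LinearMap.ker_eq_bot, LinearMap.ker_eq_bot']
  intro x hx
  by_contra h0
  let : Module R M := Module.compHom M (algebraMap R Λ)
  obtain ⟨φ, hφ⟩ := exists_apply_ne_zero_of_injectiveEnvelope R he M x h0
  let ψ : M →ₗ[Λ] RegularDual R Λ J :=
    { toFun y := (show Λ →ₗ[R] J from
        { toFun a := φ (a • y)
          map_add' a b := by rw [add_smul, map_add]
          map_smul' r a := by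
            rw [Algebra.smul_def, mul_smul]
            exact map_smul φ r (a • y) })
      map_add' y z := LinearMap.ext fun a => by
        change φ (a • (y + z)) = φ (a • y) + φ (a • z)
        rw [smul_add, map_add]
      map_smul' b y := LinearMap.ext fun a => by
        change φ (a • b • y) = φ ((a * b) • y)
        rw [mul_smul] }
  obtain ⟨χ, hχ⟩ := hf 1 (LinearMap.pi fun _ => ψ)
  have h1 := congrFun (LinearMap.congr_fun hχ x) 0
  rw [LinearMap.comp_apply, hx, map_zero] at h1
  have h2 : (0 : J) = φ ((1 : Λ) • x) :=
    congrArg (fun ξ : RegularDual R Λ J => (show Λ →ₗ[R] J from ξ) 1) h1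
  rw [one_smul] at h2
  exact hφ h2.symm

end Duality

/-! ### Decompositions into indecomposables and the sum of the projective-injectives. -/

section Decompositions

variable {S : Type u} [Ring S]

lemma nontrivial_of_indecomposable {X : ModuleCat.{u} S} (h : Indecomposable X) : Nontrivial X := by
  rw [← not_subsingleton_iff_nontrivial, ← ModuleCat.isZero_iff_subsingleton]
  exact h.1

lemma eq_bot_or_eq_bot_of_indecomposable {X : ModuleCat.{u} S} (h : Indecomposable X)
    {A B : Submodule S X} (hAB : IsCompl A B) : A = ⊥ ∨ B = ⊥ := by
  have e : X ≅ ModuleCat.of S A ⊞ ModuleCat.of S B :=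
    (A.prodEquivOfIsCompl B hAB).symm.toModuleIso ≪≫
      (ModuleCat.biprodIsoProd (ModuleCat.of S A) (ModuleCat.of S B)).symm
  refine (h.2 _ _ e).imp (fun h => ?_) (fun h => ?_) <;>
  · rw [ModuleCat.isZero_iff_subsingleton] at h
    exact (Submodule.subsingleton_iff_eq_bot).1 h

/-- Fitting: the endomorphism ring of an indecomposable module of finite length is local. -/
lemma isLocalRing_end_of_indecomposable {X : ModuleCat.{u} S} (h : Indecomposable X)
    [IsArtinian S X] [IsNoetherian S X] : IsLocalRing (Module.End S X) := by
  have := nontrivial_of_indecomposable h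
  refine IsLocalRing.of_isUnit_or_isUnit_one_sub_self fun a => ?_
  -- Besides Fitting's decomposition, `n ≥ 1` is required, so that invertibility of `a ^ n` implies
  -- that of `a`.
  obtain ⟨n, hn, hn1⟩ := ((LinearMap.eventually_isCompl_ker_pow_range_pow a).and
    (Filter.eventually_ge_atTop 1)).exists
  rcases eq_bot_or_eq_bot_of_indecomposable h hn with h0 | h0
  · left
    have hu : IsUnit (a ^ n) := (Module.End.isUnit_iff _).2
      ⟨LinearMap.ker_eq_bot.1 h0, LinearMap.range_eq_top.1 (by
        have := hn.sup_eq_top; rwa [h0, bot_sup_eq] at this)⟩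
    exact (isUnit_pow_iff (by lia)).1 hu
  · right
    exact IsNilpotent.isUnit_one_sub ⟨n, LinearMap.range_eq_bot.1 h0⟩

/-- An indecomposable module of finite length which is a direct summand of a finite direct sum of
indecomposable modules is isomorphic to one of them. -/
lemma exists_equiv_of_sum_eq_id {X : ModuleCat.{u} S} (h : Indecomposable X)
    [IsArtinian S X] [IsNoetherian S X] {ι : Type*} [Fintype ι] {Y : ι → ModuleCat.{u} S}
    (hY : ∀ j, Indecomposable (Y j)) (i : ∀ j, X →ₗ[S] Y j) (p : ∀ j, Y j →ₗ[S] X)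
    (hip : ∑ j, p j ∘ₗ i j = LinearMap.id) : ∃ j, Nonempty (X ≃ₗ[S] Y j) := by
  have := isLocalRing_end_of_indecomposable h
  have := nontrivial_of_indecomposable h
  -- In a local ring a sum equal to `1` has an invertible term. Some `p j ∘ i j` is thus an
  -- automorphism, so `X` splits off the indecomposable `Y j`.
  obtain ⟨j, -, hj⟩ := IsLocalRing.exists_of_isUnit_sum (R := Module.End S X)
    (s := Finset.univ) (f := fun j => p j ∘ₗ i j) (by rw [hip]; exact isUnit_one)
  rw [Module.End.isUnit_iff] at hj
  have hinj : Function.Injective (i j) := Function.Injective.of_comp (f := p j) hj.1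
  have hcompl : IsCompl (LinearMap.range (i j)) (LinearMap.ker (p j)) := by
    rw [isCompl_iff, Submodule.disjoint_def, codisjoint_iff_le_sup]
    refine ⟨?_, fun y _ => ?_⟩
    · rintro _ ⟨x, rfl⟩ hx
      have : x = 0 := hj.1 (by rw [map_zero]; exact hx)
      rw [this, map_zero]
    · obtain ⟨x, hx⟩ := hj.2 (p j y)
      refine Submodule.mem_sup.2 ⟨i j x, ⟨x, rfl⟩, y - i j x, ?_, by abel⟩
      rw [LinearMap.mem_ker, map_sub, sub_eq_zero]
      exact hx.symm
  refine ⟨j, ⟨LinearEquiv.ofBijective (i j) ⟨hinj, ?_⟩⟩⟩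
  rcases eq_bot_or_eq_bot_of_indecomposable (hY j) hcompl with h0 | h0
  · obtain ⟨x, hx⟩ := exists_ne (0 : X)
    refine absurd (hinj ?_) hx
    rw [map_zero]
    exact LinearMap.congr_fun (LinearMap.range_eq_bot.1 h0) x
  · rw [← LinearMap.range_eq_top]
    have := hcompl.sup_eq_top
    rwa [h0, sup_bot_eq] at this

lemma exists_decomposition_of_length (l : ℕ∞) (hl : l ≠ ⊤) : ∀ M : ModuleCat.{u} S,
    Module.length S M = l → ∃ (ι : Type) (_ : Fintype ι) (X : ι → ModuleCat.{u} S),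
      (∀ i, Indecomposable (X i)) ∧ Nonempty (M ≃ₗ[S] (∀ i, X i)) := by
  induction l using WellFoundedLT.induction with
  | ind l ih =>
  intro M hM
  by_cases h : Indecomposable M
  · exact ⟨Unit, inferInstance, fun _ => M, fun _ => h, ⟨(LinearEquiv.funUnique Unit S M).symm⟩⟩
  by_cases h0 : Subsingleton M
  · exact ⟨Empty, inferInstance, fun i => i.elim, fun i => i.elim,
      ⟨LinearEquiv.ofSubsingleton _ _⟩⟩
  obtain ⟨Y, Z, e, hY, hZ⟩ : ∃ (Y Z : ModuleCat.{u} S) (_ : M ≅ Y ⊞ Z),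
      ¬ Limits.IsZero Y ∧ ¬ Limits.IsZero Z := by
    rw [Indecomposable, ModuleCat.isZero_iff_subsingleton] at h
    push Not at h
    obtain ⟨Y, Z, e, hYZ⟩ := h (not_subsingleton_iff_nontrivial.1 h0)
    exact ⟨Y, Z, e, hYZ⟩
  let e' : M ≃ₗ[S] (Y × Z) := (e ≪≫ ModuleCat.biprodIsoProd Y Z).toLinearEquiv
  have hlen : l = Module.length S Y + Module.length S Z := by
    rw [← hM, e'.length_eq, Module.length_prod]
  rw [ModuleCat.isZero_iff_subsingleton, not_subsingleton_iff_nontrivial,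
    ← Module.length_pos_iff (R := S)] at hY hZ
  have hYl : Module.length S Y ≠ ⊤ := fun h => hl (by rw [hlen, h, top_add])
  have hZl : Module.length S Z ≠ ⊤ := fun h => hl (by rw [hlen, h, add_top])
  obtain ⟨ι, _, X, hX, ⟨eX⟩⟩ := ih _ (by
    rw [hlen]; simpa using (ENat.add_lt_add_iff_left hYl).2 hZ) hYl Y rfl
  obtain ⟨κ, _, W, hW, ⟨eW⟩⟩ := ih _ (by
    rw [hlen, add_comm]; simpa using (ENat.add_lt_add_iff_left hZl).2 hY) hZl Z rfl
  let e₁ : (Y × Z) ≃ₗ[S] ((∀ i, X i) × (∀ k, W k)) := eX.prodCongr eW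
  let e₂ : (∀ s, (Sum.elim X W s : ModuleCat.{u} S)) ≃ₗ[S] ((∀ i, X i) × (∀ k, W k)) :=
    LinearEquiv.sumPiEquivProdPi S ι κ (fun s => (Sum.elim X W s : ModuleCat.{u} S))
  refine ⟨ι ⊕ κ, inferInstance, Sum.elim X W, ?_, ⟨(e'.trans e₁).trans e₂.symm⟩⟩
  rintro (i | i)
  exacts [hX i, hW i]

lemma exists_decomposition [IsArtinianRing S] (M : ModuleCat.{u} S) (hM : Module.Finite S M) :
    ∃ (ι : Type) (_ : Fintype ι) (X : ι → ModuleCat.{u} S),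
      (∀ i, Indecomposable (X i)) ∧ Nonempty (M ≃ₗ[S] (∀ i, X i)) :=
  exists_decomposition_of_length _ (Module.length_ne_top_iff.2
    (isFiniteLength_iff_isNoetherian_isArtinian.2 ⟨inferInstance, inferInstance⟩)) M rfl

lemma sum_single_comp_proj {ι : Type*} [Fintype ι] [DecidableEq ι] {M : ModuleCat.{u} S}
    {X : ι → ModuleCat.{u} S} (e : M ≃ₗ[S] (∀ i, X i)) :
    ∑ j, (e.symm.toLinearMap ∘ₗ LinearMap.single S (fun j => X j) j) ∘ₗ
      (LinearMap.proj j ∘ₗ e.toLinearMap) = LinearMap.id := by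
  refine LinearMap.ext fun x => ?_
  rw [LinearMap.sum_apply]
  simp only [LinearMap.comp_apply, ← map_sum]
  exact (congrArg e.symm (Finset.univ_sum_single (e x))).trans (e.symm_apply_apply x)

lemma inAdd_factor {ι : Type*} {M : ModuleCat.{u} S}
    {X : ι → ModuleCat.{u} S} (e : M ≃ₗ[S] (∀ i, X i)) (j : ι) : InAdd M (X j) := by
  classical
  refine (InAdd.refl M).retract (e.symm.toLinearMap ∘ₗ LinearMap.single S (fun j => X j) j)
    (LinearMap.proj j ∘ₗ e.toLinearMap) ?_
  ext x
  simp

lemma inAdd_of_forall_factor {ι : Type*} [Fintype ι] {T M : ModuleCat.{u} S}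
    {X : ι → ModuleCat.{u} S} (e : M ≃ₗ[S] (∀ i, X i)) (h : ∀ j, InAdd T (X j)) : InAdd T M := by
  classical
  exact InAdd.of_sum h _ _ (sum_single_comp_proj e)

lemma InAdd.of_equiv {T X Y : ModuleCat.{u} S} (h : InAdd T X) (e : Y ≃ₗ[S] X) : InAdd T Y :=
  h.retract e.toLinearMap e.symm.toLinearMap (by ext; simp)

/-- Representatives of the isomorphism classes in a finite family of modules. -/
lemma exists_representatives {ι : Type} [Finite ι] (X : ι → ModuleCat.{u} S) :
    ∃ (t : ℕ) (σ : Fin t → ι), (∀ i j, Nonempty (X (σ i) ≃ₗ[S] X (σ j)) → i = j) ∧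
      ∀ k, ∃ i, Nonempty (X k ≃ₗ[S] X (σ i)) := by
  let r : Setoid ι :=
    { r i j := Nonempty (X i ≃ₗ[S] X j)
      iseqv := ⟨fun i => ⟨LinearEquiv.refl _ _⟩, fun ⟨e⟩ => ⟨e.symm⟩, fun ⟨e⟩ ⟨e'⟩ => ⟨e.trans e'⟩⟩ }
  obtain ⟨t, ⟨e⟩⟩ := Finite.exists_equiv_fin (Quotient r)
  refine ⟨t, fun i => (e.symm i).out, fun i j h => ?_, fun k => ⟨e ⟦k⟧, ?_⟩⟩
  · exact e.symm.injective (by simpa using Quotient.sound (s := r) h)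
  · beta_reduce
    rw [e.symm_apply_apply]
    exact Setoid.symm (Quotient.mk_out (s := r) k)

/-- Every finitely generated module has the same additive closure as a basic module. -/
lemma exists_isBasic_inAdd [IsArtinianRing S] (M : ModuleCat.{u} S) (hM : Module.Finite S M) :
    ∃ T : ModuleCat.{u} S, IsBasic T ∧ InAdd M T ∧ InAdd T M := by
  obtain ⟨ι, _, X, hX, ⟨e⟩⟩ := exists_decomposition M hM
  obtain ⟨t, σ, hσ, hσ'⟩ := exists_representatives X
  refine ⟨ModuleCat.of S (∀ i, X (σ i)), ⟨t, fun i => X (σ i), fun i => hX _, hσ,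
    ⟨LinearEquiv.refl _ _⟩⟩, InAdd.pi fun i => inAdd_factor e _, ?_⟩
  refine inAdd_of_forall_factor e fun j => ?_
  obtain ⟨i, ⟨e'⟩⟩ := hσ' j
  exact (inAdd_factor (X := fun i => X (σ i)) (LinearEquiv.refl _ _) i).of_equiv e'

lemma inAdd_self_of_projective (M : ModuleCat.{u} S) (hM : Module.Finite S M)
    (hP : Module.Projective S M) : InAdd (ModuleCat.of S S) M := by
  obtain ⟨n, f, hf⟩ := Module.Finite.exists_fin' S M
  obtain ⟨g, hg⟩ := Module.projective_lifting_property f LinearMap.id hf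
  exact ⟨n, g, f, hg⟩

/-- The direct sum of the indecomposable projective-injective modules exists. -/
lemma exists_isProjInjSum [IsArtinianRing S] : ∃ Q : ModuleCat.{u} S, IsProjInjSum Q := by
  -- Indecomposable projectives all occur as summands of the regular module, so representatives of
  -- its injective summands suffice.
  obtain ⟨ι, _, X, hX, ⟨e⟩⟩ := exists_decomposition (ModuleCat.of S S) (Module.Finite.self S)
  let κ := {i : ι // Module.Injective S (X i)}
  obtain ⟨t, σ, hσ, hσ'⟩ := exists_representatives fun k : κ => X k.1
  refine ⟨ModuleCat.of S (∀ i, X (σ i).1), t, fun i => X (σ i).1, fun i => ⟨?_, hX _, ?_, (σ i).2⟩,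
    hσ, fun P hP => ?_, ⟨LinearEquiv.refl _ _⟩⟩
  · exact (inAdd_factor e _).finite (Module.Finite.self S)
  · exact (inAdd_factor e _).projective (inferInstanceAs (Module.Projective S S))
  · have := hP.finite
    obtain ⟨n, i, p, hip⟩ := (inAdd_self_of_projective P hP.finite hP.projective).exists_sum
    classical
    have hsum := sum_single_comp_proj e
    obtain ⟨⟨_, j⟩, ⟨e'⟩⟩ := exists_equiv_of_sum_eq_id hP.indecomposable (ι := Fin n × ι)
      (Y := fun s => X s.2) (fun s => hX s.2)
      (fun s => (LinearMap.proj s.2 ∘ₗ e.toLinearMap) ∘ₗ i s.1)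
      (fun s => p s.1 ∘ₗ (e.symm.toLinearMap ∘ₗ LinearMap.single S (fun j => X j) s.2)) (by
        rw [← hip, Fintype.sum_prod_type]
        refine Finset.sum_congr rfl fun k _ => LinearMap.ext fun x => ?_
        have := congrArg (p k) (LinearMap.congr_fun hsum (i k x))
        rw [LinearMap.sum_apply, map_sum] at this
        rw [LinearMap.sum_apply]
        exact this)
    have : Module.Injective S (X j) :=
      ((InAdd.refl P).of_equiv e'.symm).injective hP.injective
    obtain ⟨i, ⟨e''⟩⟩ := hσ' ⟨j, this⟩
    exact ⟨i, ⟨e'.trans e''⟩⟩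

lemma IsProjInjSum.finite {Q : ModuleCat.{u} S} (hQ : IsProjInjSum Q) : Module.Finite S Q := by
  obtain ⟨t, X, hX, -, -, ⟨e⟩⟩ := hQ
  have := fun i => (hX i).finite
  exact Module.Finite.equiv e.symm

lemma IsProjInjSum.projective {Q : ModuleCat.{u} S} (hQ : IsProjInjSum Q) :
    Module.Projective S Q := by
  obtain ⟨t, X, hX, -, -, ⟨e⟩⟩ := hQ
  rw [IsProjective.iff_projective, projective_iff_subsingleton_ext_one]
  exact fun Y => ext_subsingleton_left_of_sum _ _ (sum_single_comp_proj e)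
    fun j => ext_subsingleton_of_projective (hX j).projective Y 0

lemma IsProjInjSum.injective {Q : ModuleCat.{u} S} (hQ : IsProjInjSum Q) :
    Module.Injective S Q := by
  obtain ⟨t, X, hX, -, -, ⟨e⟩⟩ := hQ
  rw [Module.injective_iff_injective_object, injective_iff_subsingleton_ext_one]
  exact fun Y => ext_subsingleton_right_of_sum _ _ (sum_single_comp_proj e)
    fun j => ext_subsingleton_of_injective (hX j).injective Y 0

lemma IsProjInjSum.inAdd {Q : ModuleCat.{u} S} (hQ : IsProjInjSum Q) [IsArtinianRing S]
    {M : ModuleCat.{u} S} (hM : Module.Finite S M) (hP : Module.Projective S M)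
    (hI : Module.Injective S M) : InAdd Q M := by
  obtain ⟨t, X, hX, -, hX', ⟨e⟩⟩ := hQ
  obtain ⟨ι, _, Y, hY, ⟨eY⟩⟩ := exists_decomposition M hM
  refine inAdd_of_forall_factor eY fun j => ?_
  have hj := inAdd_factor eY j
  obtain ⟨i, ⟨e'⟩⟩ := hX' (Y j) ⟨hj.finite hM, hY j, hj.projective hP, hj.injective hI⟩
  exact (inAdd_factor e i).of_equiv e'

end Decompositions

/-! ### Projective, injective and global dimension. -/

section Dimensions

variable {S : Type u} [Ring S]

lemma exists_section_of_ext_one {X Y Z : ModuleCat.{u} S} {f : X →ₗ[S] Y} {g : Y →ₗ[S] Z}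
    (hf : Function.Injective f) (h : Function.Exact f g)
    (hg : Function.Surjective g) (hX : Subsingleton (Ext.{u} Z X 1)) :
    ∃ s : Z →ₗ[S] Y, g ∘ₗ s = LinearMap.id := by
  obtain ⟨x₂, hx₂⟩ := Ext.covariant_sequence_exact₃ Z (shortExact_of_exact hf h hg)
    (Ext.mk₀ (𝟙 Z)) (zero_add 1) (Subsingleton.elim _ _)
  obtain ⟨ψ, rfl⟩ := Ext.mk₀_bijective _ _ |>.2 x₂
  refine ⟨ψ.hom, ?_⟩
  rw [Ext.mk₀_comp_mk₀] at hx₂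
  exact congrArg ModuleCat.Hom.hom ((Ext.mk₀_bijective _ _).1 hx₂)

lemma exists_syzygy [IsNoetherianRing S] (M : ModuleCat.{u} S) (hM : Module.Finite S M) :
    ∃ (N P : ModuleCat.{u} S) (f : N →ₗ[S] P) (g : P →ₗ[S] M), Module.Finite S N ∧
      Module.Projective S P ∧ Function.Injective f ∧ Function.Exact f g ∧
      Function.Surjective g := by
  obtain ⟨n, g, hg⟩ := Module.Finite.exists_fin' S M
  exact ⟨ModuleCat.of S (LinearMap.ker g), ModuleCat.of S (Fin n → S), (LinearMap.ker g).subtype, g,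
    inferInstance, inferInstanceAs (Module.Projective S (Fin n → S)), Subtype.val_injective,
    LinearMap.exact_subtype_ker_map g, hg⟩

/-- If the regular module has injective dimension at most two, then a finitely generated module of
projective dimension at most three has projective dimension at most two. -/
lemma hasProjectiveDimensionLT_three_of_four [IsNoetherianRing S]
    (hS : HasInjectiveDimensionLT (ModuleCat.of S S) 3) (M : ModuleCat.{u} S)
    (hM : Module.Finite S M) (hpd : HasProjectiveDimensionLT M 4) :
    HasProjectiveDimensionLT M 3 := by
  obtain ⟨N₁, P₀, f₀, g₀, hN₁, hP₀, hf₀, hfg₀, hg₀⟩ := exists_syzygy M hM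
  obtain ⟨N₂, P₁, f₁, g₁, hN₂, hP₁, hf₁, hfg₁, hg₁⟩ := exists_syzygy N₁ hN₁
  obtain ⟨N₃, P₂, f₂, g₂, hN₃, hP₂, hf₂, hfg₂, hg₂⟩ := exists_syzygy N₂ hN₂
  have hP₀' : Projective P₀ := (IsProjective.iff_projective P₀).1 hP₀
  have hP₁' : Projective P₁ := (IsProjective.iff_projective P₁).1 hP₁
  have hP₂' : Projective P₂ := (IsProjective.iff_projective P₂).1 hP₂
  have s₀ := shortExact_of_exact hf₀ hfg₀ hg₀
  have s₁ := shortExact_of_exact hf₁ hfg₁ hg₁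
  have s₂ := shortExact_of_exact hf₂ hfg₂ hg₂
  have d₁ : HasProjectiveDimensionLT N₁ 3 := (s₀.hasProjectiveDimensionLT_X₃_iff 2 hP₀').1 hpd
  have d₂ : HasProjectiveDimensionLT N₂ 2 := (s₁.hasProjectiveDimensionLT_X₃_iff 1 hP₁').1 d₁
  have d₃ : HasProjectiveDimensionLT N₃ 1 := (s₂.hasProjectiveDimensionLT_X₃_iff 0 hP₂').1 d₂
  have hN₃' : Module.Projective S N₃ :=
    (IsProjective.iff_projective N₃).2 (projective_iff_hasProjectiveDimensionLT_one.2 d₃)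
  -- The third syzygy `N₃` is finitely generated projective, so it inherits `id ≤ 2` from the
  -- regular module. Shifting, `Ext¹(N₂, N₃)` vanishes along with `Ext³(M, N₃)`; hence `P₂ → N₂`
  -- splits and the resolution stops one step earlier.
  have e₃ : Subsingleton (Ext.{u} M N₃ 3) :=
    (inAdd_self_of_projective N₃ hN₃ hN₃').ext_right
      (HasInjectiveDimensionLT.subsingleton (ModuleCat.of S S) 3 3 le_rfl M)
  have e₁ : Subsingleton (Ext.{u} N₂ N₃ 1) :=
    ext_subsingleton_left_sub hf₁ hfg₁ hg₁ (ext_subsingleton_of_projective hP₁ N₃ 0)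
      (ext_subsingleton_left_sub hf₀ hfg₀ hg₀ (ext_subsingleton_of_projective hP₀ N₃ 1) e₃)
  obtain ⟨s, hs⟩ := exists_section_of_ext_one hf₂ hfg₂ hg₂ e₁
  have hN₂' : Module.Projective S N₂ := Module.Projective.of_split s g₂ hs
  have d₂' : HasProjectiveDimensionLT N₂ 1 :=
    projective_iff_hasProjectiveDimensionLT_one.1 ((IsProjective.iff_projective N₂).1 hN₂')
  exact (s₀.hasProjectiveDimensionLT_X₃_iff 1 hP₀').2
    ((s₁.hasProjectiveDimensionLT_X₃_iff 0 hP₁').2 d₂')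

/-- If the regular module has injective dimension at most two, then a finitely generated module of
finite projective dimension has projective dimension at most two. -/
lemma hasProjectiveDimensionLT_three [IsNoetherianRing S]
    (hS : HasInjectiveDimensionLT (ModuleCat.of S S) 3) (n : ℕ) : ∀ M : ModuleCat.{u} S,
    Module.Finite S M → HasProjectiveDimensionLT M (n + 3) → HasProjectiveDimensionLT M 3 := by
  induction n with
  | zero => exact fun M _ h => h
  | succ n ih =>
    intro M hM h
    obtain ⟨N, P, f, g, hN, hP, hf, hfg, hg⟩ := exists_syzygy M hM
    have hP' : Projective P := (IsProjective.iff_projective P).1 hP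
    have s := shortExact_of_exact hf hfg hg
    have h' : HasProjectiveDimensionLT M (n + 2 + 2) := by
      rwa [show n + 2 + 2 = n + 1 + 3 by lia]
    refine hasProjectiveDimensionLT_three_of_four hS M hM
      ((s.hasProjectiveDimensionLT_X₃_iff 2 hP').2 (ih N hN ?_))
    exact (s.hasProjectiveDimensionLT_X₃_iff (n + 2) hP').1 h'

lemma globalDim_le_two_of_injectiveDimension [IsNoetherianRing S]
    (hS : HasInjectiveDimensionLT (ModuleCat.of S S) 3) (hgl : globalDim S < ⊤) :
    globalDim S ≤ 2 := by
  refine iSup₂_le fun M hM => ?_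
  have hlt : projectiveDimension M < ⊤ :=
    (le_iSup₂ (f := fun (M : ModuleCat.{u} S) (_ : Module.Finite S M) => projectiveDimension M)
      M hM).trans_lt hgl
  obtain ⟨n, hn⟩ := (projectiveDimension_ne_top_iff M).1 hlt.ne
  refine (projectiveDimension_le_iff M 2).2 (hasProjectiveDimensionLT_three hS n M hM ?_)
  exact hasProjectiveDimensionLT_of_ge M (n + 1) (n + 3) (by lia)

lemma hasProjectiveDimensionLT_of_globalDim_le_two (h : globalDim S ≤ 2) (M : ModuleCat.{u} S)
    (hM : Module.Finite S M) : HasProjectiveDimensionLT M 3 :=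
  (projectiveDimension_le_iff M 2).1
    ((le_iSup₂ (f := fun (M : ModuleCat.{u} S) (_ : Module.Finite S M) => projectiveDimension M)
      M hM).trans h)

lemma InAdd.hasInjectiveDimensionLT {T X : ModuleCat.{u} S} (h : InAdd T X) {n : ℕ}
    (hT : HasInjectiveDimensionLT T n) : HasInjectiveDimensionLT X n :=
  HasInjectiveDimensionLT.mk fun i hi Y _ =>
    (h.ext_right (HasInjectiveDimensionLT.subsingleton T n i hi Y)).elim _ _

lemma InAdd.hasProjectiveDimensionLT {T X : ModuleCat.{u} S} (h : InAdd T X) {n : ℕ}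
    (hT : HasProjectiveDimensionLT T n) : HasProjectiveDimensionLT X n :=
  HasProjectiveDimensionLT.mk fun i hi Y _ =>
    (h.ext_left (HasProjectiveDimensionLT.subsingleton T n i hi Y)).elim _ _

/-- A module is injective if `Ext¹` from all finitely generated modules into it vanishes. -/
lemma injective_of_forall_finite {X : ModuleCat.{u} S}
    (h : ∀ M : ModuleCat.{u} S, Module.Finite S M → Subsingleton (Ext.{u} M X 1)) :
    Module.Injective S X := by
  -- Baer's criterion only tests the cyclic modules `S ⧸ I`.
  refine Module.Baer.injective fun I φ => ?_
  obtain ⟨ψ, hψ⟩ := exists_extension_of_ext_one (X := ModuleCat.of S I) (Y := ModuleCat.of S S)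
    (Z := ModuleCat.of S (S ⧸ I)) (f := I.subtype) (g := I.mkQ) I.injective_subtype
    (LinearMap.exact_subtype_mkQ I) I.mkQ_surjective
    (h _ (inferInstanceAs (Module.Finite S (S ⧸ I)))) φ
  exact ⟨ψ, fun x hx => LinearMap.congr_fun hψ ⟨x, hx⟩⟩

lemma InCogen.finite [IsNoetherianRing S] {T X : ModuleCat.{u} S} (h : InCogen T X)
    (hT : Module.Finite S T) : Module.Finite S X := by
  obtain ⟨m, f, hf⟩ := h
  exact Module.Finite.of_injective f hf

section Prod

variable {X Y : ModuleCat.{u} S}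

/-- The family consisting of two modules. -/
abbrev pair (X Y : ModuleCat.{u} S) (b : Bool) : ModuleCat.{u} S := bif b then X else Y

/-- The projections of a product of two modules. -/
def pairProj (X Y : ModuleCat.{u} S) : ∀ b, ModuleCat.of S (X × Y) →ₗ[S] pair X Y b
  | true => LinearMap.fst S X Y
  | false => LinearMap.snd S X Y

/-- The inclusions into a product of two modules. -/
def pairIncl (X Y : ModuleCat.{u} S) : ∀ b, pair X Y b →ₗ[S] ModuleCat.of S (X × Y)
  | true => LinearMap.inl S X Y
  | false => LinearMap.inr S X Y

lemma sum_pairIncl_comp_pairProj (X Y : ModuleCat.{u} S) :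
    ∑ b, pairIncl X Y b ∘ₗ pairProj X Y b = LinearMap.id := by
  rw [Fintype.sum_bool]
  refine LinearMap.ext fun x => ?_
  change ((x.1, 0) : X × Y) + (0, x.2) = x
  simp

lemma ext_subsingleton_left_prod {W : ModuleCat.{u} S} {n : ℕ}
    (hX : Subsingleton (Ext.{u} X W n)) (hY : Subsingleton (Ext.{u} Y W n)) :
    Subsingleton (Ext.{u} (ModuleCat.of S (X × Y)) W n) :=
  ext_subsingleton_left_of_sum _ _ (sum_pairIncl_comp_pairProj X Y)
    (by rintro (_ | _) <;> assumption)

lemma ext_subsingleton_right_prod {W : ModuleCat.{u} S} {n : ℕ}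
    (hX : Subsingleton (Ext.{u} W X n)) (hY : Subsingleton (Ext.{u} W Y n)) :
    Subsingleton (Ext.{u} W (ModuleCat.of S (X × Y)) n) :=
  ext_subsingleton_right_of_sum _ _ (sum_pairIncl_comp_pairProj X Y)
    (by rintro (_ | _) <;> assumption)

lemma InAdd.prod {T : ModuleCat.{u} S} (hX : InAdd T X) (hY : InAdd T Y) :
    InAdd T (ModuleCat.of S (X × Y)) :=
  InAdd.of_sum (by rintro (_ | _) <;> assumption) _ _ (sum_pairIncl_comp_pairProj X Y)

lemma inAdd_prod_left (X Y : ModuleCat.{u} S) : InAdd (ModuleCat.of S (X × Y)) X :=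
  (InAdd.refl _).retract (LinearMap.inl S X Y) (LinearMap.fst S X Y) (LinearMap.fst_comp_inl S X Y)

lemma inAdd_prod_right (X Y : ModuleCat.{u} S) : InAdd (ModuleCat.of S (X × Y)) Y :=
  (InAdd.refl _).retract (LinearMap.inr S X Y) (LinearMap.snd S X Y) (LinearMap.snd_comp_inr S X Y)

end Prod

end Dimensions

/-! ### From a tilting-cotilting module to an Auslander algebra. -/

section Forward

variable {Λ : Type u} [Ring Λ]

/-- If a tilting module `T` is generated and cogenerated by the projective-injective module `Q`,
then the cokernel of a left `add Q`-approximation of the regular module lies in `add T`. -/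
lemma exists_embedding_cokernel_inAdd (R : Type u) [CommRing R] [IsArtinianRing R] [Algebra R Λ]
    [Module.Finite R Λ] {T Q : ModuleCat.{u} Λ} (hQ : Module.Finite Λ Q)
    (hQp : Module.Projective Λ Q) (hQi : Module.Injective Λ Q) (hgen : InGen Q T)
    (hcogen : InCogen Q T) (hT : IsTilting T) :
    ∃ (m : ℕ) (f : Λ →ₗ[Λ] (Fin m → Q)), Function.Injective f ∧
      InAdd T (ModuleCat.of Λ ((Fin m → Q) ⧸ LinearMap.range f)) := by
  obtain ⟨T₀, T₁, a, b, h₀, h₁, ha, hab, hb⟩ := hT.coresolution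
  have hΛT : InCogen T (ModuleCat.of Λ Λ) := h₀.inCogen.of_injective (Y := ModuleCat.of Λ Λ) a ha
  -- `Q` embeds in a power of `Λ`, hence in a power of `T`, and being injective it splits off.
  have hQT : InAdd T Q :=
    (hΛT.trans (inAdd_self_of_projective Q hQ hQp).inCogen).inAdd_of_injective hQi
  obtain ⟨m, f, hf⟩ := exists_left_approximation R Q (ModuleCat.of Λ Λ) hQ (Module.Finite.self Λ)
  have hfinj : Function.Injective f := by
    obtain ⟨n, i, hi⟩ := hcogen.trans hΛT
    obtain ⟨χ, rfl⟩ := hf n i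
    exact Function.Injective.of_comp (f := χ) hi
  have hQm : InAdd Q (ModuleCat.of Λ (Fin m → Q)) := InAdd.pi fun _ => InAdd.refl Q
  have hQmp : Module.Projective Λ (Fin m → Q) := hQm.projective hQp
  let K : ModuleCat.{u} Λ := ModuleCat.of Λ ((Fin m → Q) ⧸ LinearMap.range f)
  let π : (Fin m → Q) →ₗ[Λ] K := (LinearMap.range f).mkQ
  have hπ : Function.Surjective π := Submodule.mkQ_surjective _
  have hKQ : InGen Q K := hQm.inGen.of_surjective π hπ
  have hfin : Module.Finite Λ (Fin m → Q) := inferInstance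
  have hK : Module.Finite Λ K := Module.Finite.of_surjective π hπ
  obtain ⟨n, p, hp, hL, -⟩ := exists_approximation_of_inGen R hT.finite hK (hQT.inGen.trans hKQ)
    hT.ext_self h₀ h₁ a b ha hab hb
  obtain ⟨c, r, hr⟩ := hgen.trans hL
  obtain ⟨h, hh⟩ := Module.projective_lifting_property p π hp
  have hhf : ∀ x, h (f x) ∈ LinearMap.ker p := fun x => by
    rw [LinearMap.mem_ker, ← LinearMap.comp_apply, hh]
    exact (Submodule.Quotient.mk_eq_zero _).2 ⟨x, rfl⟩
  -- The lift `h` of `π` sends `Λ` into `ker p`. This restriction factors through `r : Q^c → ker p`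
  -- because `Λ` is projective, and then through `f` because `f` is a left approximation.
  -- Subtracting the resulting map from `h` gives a lift that kills `Λ`, hence a section of `p`.
  obtain ⟨u, hu⟩ := Module.projective_lifting_property (P := Λ) r
    (LinearMap.codRestrict (LinearMap.ker p) (h ∘ₗ f) hhf) hr
  obtain ⟨χ, hχ⟩ := hf c u
  let s : (Fin m → Q) →ₗ[Λ] (Fin n → T) := h - (LinearMap.ker p).subtype ∘ₗ r ∘ₗ χ
  have hs : LinearMap.range f ≤ LinearMap.ker s := by
    rintro _ ⟨x, rfl⟩
    have h1 : χ (f x) = u x := LinearMap.congr_fun hχ x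
    have h2 : r (u x) = ⟨h (f x), hhf x⟩ := LinearMap.congr_fun hu x
    change h (f x) - (r (χ (f x))).1 = 0
    rw [h1, h2, sub_self]
  have hps : p ∘ₗ s = π := by
    rw [← hh]
    refine LinearMap.ext fun x => ?_
    change p (h x - (r (χ x)).1) = p (h x)
    rw [map_sub, (r (χ x)).2, sub_zero]
  refine ⟨m, f, hfinj, ?_⟩
  refine InAdd.retract (Y := ModuleCat.of Λ (Fin n → T)) (InAdd.pi fun _ => InAdd.refl T)
    ((LinearMap.range f).liftQ s hs) p ?_
  refine Submodule.linearMap_qext _ (LinearMap.ext fun x => ?_)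
  exact LinearMap.congr_fun hps x

/-- If the regular module embeds into a power of a projective-injective module `Q` with cokernel
cogenerated by `Q`, then the dominant dimension is at least two. -/
lemma two_le_domDim {Q : ModuleCat.{u} Λ} (hQp : Module.Projective Λ Q)
    (hQi : Module.Injective Λ Q) {m : ℕ} (f : Λ →ₗ[Λ] (Fin m → Q)) (hf : Function.Injective f)
    (hK : InCogen Q (ModuleCat.of Λ ((Fin m → Q) ⧸ LinearMap.range f))) : 2 ≤ domDim Λ := by
  obtain ⟨J⟩ := nonempty_minimalInjectiveResolution (ModuleCat.of Λ Λ)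
  have hQm : Module.Injective Λ (Fin m → Q) := (InAdd.pi fun _ => InAdd.refl Q).injective hQi
  -- Minimality makes `g` injective, so `I₀ ∈ add Q`. Moreover `g` induces an embedding of `I₀ ⧸ Λ`,
  -- which is the image of `d 0`, into the cokernel of `f`; essentiality carries cogeneration by `Q`
  -- on to `I₁`.
  obtain ⟨g, hg⟩ := hQm.out J.ε J.injective_ε f
  have hginj : Function.Injective g := by
    rw [← LinearMap.ker_eq_bot]
    refine J.essential_zero _ ?_
    rw [Submodule.eq_bot_iff]
    rintro _ ⟨hx, x, rfl⟩
    have : f x = f 0 := by rw [← hg, map_zero]; exact hx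
    rw [hf this, map_zero]
  have h0 : Module.Projective Λ (J.I 0) :=
    (InCogen.inAdd_of_injective ⟨m, g, hginj⟩ (J.injective_module 0)).projective hQp
  have hrange : InCogen Q (ModuleCat.of Λ (LinearMap.range (J.d 0))) := by
    let φ : J.I 0 →ₗ[Λ] ((Fin m → Q) ⧸ LinearMap.range f) := (LinearMap.range f).mkQ ∘ₗ g
    have hφ : LinearMap.ker φ = LinearMap.ker (J.d 0) := by
      ext x
      rw [LinearMap.mem_ker, LinearMap.mem_ker, J.exact_zero x]
      refine (Submodule.Quotient.mk_eq_zero _).trans ⟨?_, ?_⟩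
      · rintro ⟨y, hy⟩
        exact ⟨y, hginj ((hg y).trans hy)⟩
      · rintro ⟨y, rfl⟩
        exact ⟨y, (hg y).symm⟩
    let e := (J.d 0).quotKerEquivRange
    refine hK.of_injective (Y := ModuleCat.of Λ (LinearMap.range (J.d 0)))
      ((LinearMap.ker (J.d 0)).liftQ φ hφ.ge ∘ₗ e.symm.toLinearMap) ?_
    exact (LinearMap.ker_eq_bot.1 (Submodule.ker_liftQ_eq_bot _ _ hφ.ge hφ.le)).comp e.symm.injective
  have h1 : Module.Projective Λ (J.I 1) :=
    ((inCogen_of_essential hQi _ (J.essential_succ 0) hrange).inAdd_of_injective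
      (J.injective_module 1)).projective hQp
  refine le_iSup₂_of_le 2 ⟨J, fun i hi => ?_⟩ le_rfl
  interval_cases i
  exacts [h0, h1]

theorem isAuslander_of_isTilting (R : Type u) [CommRing R] [IsArtinianRing R] [Algebra R Λ]
    [Module.Finite R Λ] (hgl : globalDim Λ < ⊤) {T : ModuleCat.{u} Λ} (hC : InC T)
    (hT : IsTilting T) (hid : injectiveDimension T ≤ 1) : IsAuslander Λ := by
  obtain ⟨-, Q, hQ, hgen, hcogen⟩ := hC
  have : IsNoetherianRing Λ := IsNoetherianRing.of_finite R Λ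
  obtain ⟨m, f, hf, hK⟩ := exists_embedding_cokernel_inAdd R hQ.finite hQ.projective hQ.injective
    hgen hcogen hT
  refine ⟨globalDim_le_two_of_injectiveDimension ?_ hgl,
    two_le_domDim hQ.projective hQ.injective f hf (hcogen.trans hK.inCogen)⟩
  have hKid := hK.hasInjectiveDimensionLT ((injectiveDimension_le_iff T 1).1 hid)
  have hQm : Module.Injective Λ (ModuleCat.of Λ (Fin m → Q)) :=
    (InAdd.pi fun _ => InAdd.refl Q).injective hQ.injective
  have hQm' : Injective (ModuleCat.of Λ (Fin m → Q)) :=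
    (Module.injective_iff_injective_object Λ _).1 hQm
  -- In `0 → Λ → Q^m → K → 0` the middle term is injective and `id K ≤ 1`, so `id Λ ≤ 2`; the index
  -- 3 encodes this as a strict bound.
  exact (shortExact_of_exact (X := ModuleCat.of Λ Λ) (Y := ModuleCat.of Λ (Fin m → Q))
    (Z := ModuleCat.of Λ ((Fin m → Q) ⧸ LinearMap.range f)) hf (LinearMap.exact_map_mkQ_range f)
    (Submodule.mkQ_surjective _)).hasInjectiveDimensionLT_X₁ 2 hKid
      (hasInjectiveDimensionLT_of_ge _ 1 3 (by lia))

end Forward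

/-! ### From an Auslander algebra to a tilting-cotilting module. -/

section Backward

variable {Λ : Type u} [Ring Λ]

lemma exists_resolution_of_two_le_domDim (h : 2 ≤ domDim Λ) :
    ∃ J : MinimalInjectiveResolution (ModuleCat.of Λ Λ),
      Module.Projective Λ (J.I 0) ∧ Module.Projective Λ (J.I 1) := by
  -- A strict bound below the supremum produces an actual index `k ≥ 2` with its resolution.
  have h1 : (1 : ℕ∞) < domDim Λ := lt_of_lt_of_le (by norm_num) h
  obtain ⟨k, hk⟩ := lt_iSup_iff.1 h1
  obtain ⟨⟨J, hJ⟩, hk⟩ := lt_iSup_iff.1 hk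
  have hk' : 1 < k := by exact_mod_cast hk
  exact ⟨J, hJ 0 (by lia), hJ 1 hk'⟩

/-- A finitely generated injective module is generated by every injective module that contains the
regular module. -/
lemma inGen_of_injective {I E : ModuleCat.{u} Λ} (ε : Λ →ₗ[Λ] I) (hε : Function.Injective ε)
    (hE : Module.Injective Λ E) (hfin : Module.Finite Λ E) : InGen I E := by
  obtain ⟨n, g, hg⟩ := Module.Finite.exists_fin' Λ E
  obtain ⟨h, hh⟩ := hE.out (X := Fin n → Λ) (Y := Fin n → I)
    (LinearMap.pi fun j => ε ∘ₗ LinearMap.proj j)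
    (fun x y hxy => funext fun j => hε (congrFun hxy j)) g
  refine ⟨n, h, fun y => ?_⟩
  obtain ⟨x, rfl⟩ := hg y
  exact ⟨_, hh x⟩

variable {I₀ I₁ : ModuleCat.{u} Λ} {ε : Λ →ₗ[Λ] I₀} {d : I₀ →ₗ[Λ] I₁}

/-- The range of a linear map, as an object. -/
abbrev rangeObj (d : I₀ →ₗ[Λ] I₁) : ModuleCat.{u} Λ := ModuleCat.of Λ (LinearMap.range d)

lemma exact_rangeRestrict (h : Function.Exact ε d) : Function.Exact ε d.rangeRestrict := fun y => by
  rw [← h y]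
  exact Subtype.ext_iff

lemma exists_isTilting_isCotilting (R : Type u) [CommRing R] [IsArtinianRing R] [Algebra R Λ]
    [Module.Finite R Λ] (hgl : globalDim Λ ≤ 2)
    (h₀ : Module.Finite Λ I₀) (h₁ : Module.Finite Λ I₁) (hp₀ : Module.Projective Λ I₀)
    (hi₀ : Module.Injective Λ I₀) (hp₁ : Module.Projective Λ I₁)
    (hi₁ : Module.Injective Λ I₁) (hε : Function.Injective ε) (hex : Function.Exact ε d)
    {J : ModuleCat.{u} R} {e : ModuleCat.of R (R ⧸ Ring.jacobson R) →ₗ[R] J}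
    (he : IsInjectiveEnvelope e) (hDf : Module.Finite Λ (RegularDual R Λ J))
    (hDi : Module.Injective Λ (RegularDual R Λ J)) :
    ∃ T : ModuleCat.{u} Λ, InC T ∧ IsTilting T ∧ IsCotilting R T := by
  have : IsNoetherianRing Λ := IsNoetherianRing.of_finite R Λ
  have : IsArtinianRing Λ := IsArtinianRing.of_finite R Λ
  let K : ModuleCat.{u} Λ := rangeObj d
  let M : ModuleCat.{u} Λ := ModuleCat.of Λ (I₀ × K)
  let g : I₀ →ₗ[Λ] K := d.rangeRestrict
  have hg : Function.Surjective g := LinearMap.surjective_rangeRestrict d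
  have hεg : Function.Exact ε g := exact_rangeRestrict hex
  have hK : Module.Finite Λ K := inferInstanceAs (Module.Finite Λ (LinearMap.range d))
  have hM : Module.Finite Λ M := inferInstanceAs (Module.Finite Λ (I₀ × K))
  obtain ⟨T, hbasic, hMT, hTM⟩ := exists_isBasic_inAdd M hM
  have hTf : Module.Finite Λ T := hMT.finite hM
  have hTI₀ : InAdd T I₀ := hTM.trans (inAdd_prod_left I₀ K)
  have hTK : InAdd T K := hTM.trans (inAdd_prod_right I₀ K)
  have hpdK : HasProjectiveDimensionLT K 2 := by
    have : Projective I₀ := (IsProjective.iff_projective I₀).1 hp₀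
    refine ((shortExact_of_exact (X := ModuleCat.of Λ Λ) hε hεg hg).hasProjectiveDimensionLT_X₃_iff 0
      this).2 ?_
    exact projective_iff_hasProjectiveDimensionLT_one.1
      ((IsProjective.iff_projective _).1 (inferInstanceAs (Module.Projective Λ Λ)))
  have hidK : HasInjectiveDimensionLT K 2 := by
    have hKi : Function.Injective (LinearMap.range d).subtype := Subtype.val_injective
    have hKex := LinearMap.exact_subtype_mkQ (LinearMap.range d)
    have hKs : Function.Surjective (LinearMap.range d).mkQ := Submodule.mkQ_surjective _
    -- Shifting through `K → I₁` and `Λ → I₀` reduces `Ext¹(N, I₁ ⧸ K)` to `Ext³(N, Λ)`, which is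
    -- zero. Only finitely generated `N` are tested, as `globalDim` bounds only these.
    have hC : Module.Injective Λ (ModuleCat.of Λ (I₁ ⧸ LinearMap.range d)) := by
      refine injective_of_forall_finite fun N hN => ?_
      have hN3 := hasProjectiveDimensionLT_of_globalDim_le_two hgl N hN
      refine ext_subsingleton_right_quotient (X := K) (Y := I₁) hKi hKex hKs
        (ext_subsingleton_of_injective hi₁ N 0) ?_
      refine ext_subsingleton_right_quotient (X := ModuleCat.of Λ Λ) hε hεg hg
        (ext_subsingleton_of_injective hi₀ N 1) ?_
      exact HasProjectiveDimensionLT.subsingleton N 3 3 le_rfl _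
    have : Injective I₁ := (Module.injective_iff_injective_object Λ I₁).1 hi₁
    refine ((shortExact_of_exact (X := K) (Y := I₁)
      (Z := ModuleCat.of Λ (I₁ ⧸ LinearMap.range d)) hKi hKex hKs).hasInjectiveDimensionLT_X₃_iff 0
      this).1 ?_
    exact injective_iff_hasInjectiveDimensionLT_one.1
      ((Module.injective_iff_injective_object Λ _).1 hC)
  have hpdM : HasProjectiveDimensionLT M 2 :=
    HasProjectiveDimensionLT.mk fun i hi Y _ => by
      obtain ⟨j, rfl⟩ := Nat.exists_eq_add_of_le' hi
      exact (ext_subsingleton_left_prod (ext_subsingleton_of_projective hp₀ Y (j + 1))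
        (HasProjectiveDimensionLT.subsingleton K 2 (j + 2) hi Y)).elim _ _
  have hidM : HasInjectiveDimensionLT M 2 :=
    HasInjectiveDimensionLT.mk fun i hi Y _ => by
      obtain ⟨j, rfl⟩ := Nat.exists_eq_add_of_le' hi
      exact (ext_subsingleton_right_prod (ext_subsingleton_of_injective hi₀ Y (j + 1))
        (HasInjectiveDimensionLT.subsingleton K 2 (j + 2) hi Y)).elim _ _
  -- `Ext¹(K, K)` lies between `Ext¹(K, I₀) = 0` and `Ext²(K, Λ)`, the latter being zero by `pd K ≤
  -- 1`.
  have hextK : Subsingleton (Ext.{u} K K 1) :=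
    ext_subsingleton_right_quotient (X := ModuleCat.of Λ Λ) hε hεg hg
      (ext_subsingleton_of_injective hi₀ K 0)
      (HasProjectiveDimensionLT.subsingleton K 2 2 le_rfl _)
  have hextM : Subsingleton (Ext.{u} M M 1) :=
    ext_subsingleton_left_prod (ext_subsingleton_of_projective hp₀ M 0)
      (ext_subsingleton_right_prod (ext_subsingleton_of_injective hi₀ K 0) hextK)
  have hext : Subsingleton (Ext.{u} T T 1) := hMT.ext_left (hMT.ext_right hextM)
  have hgenM : InGen I₀ M := by
    refine ((InAdd.refl I₀).prod (InAdd.refl I₀)).inGen.of_surjective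
      (LinearMap.prodMap LinearMap.id g) ?_
    exact Function.Surjective.prodMap Function.surjective_id hg
  have hgenT : InGen I₀ T := hgenM.trans hMT.inGen
  refine ⟨T, ⟨hTf, ?_⟩, ⟨hTf, hbasic, ?_, hext, I₀, K, ε, g, hTI₀, hTK, hε, hεg, hg⟩,
    ⟨hTf, ?_, hext, J, e, he, ?_⟩⟩
  · obtain ⟨Q, hQ⟩ := exists_isProjInjSum (S := Λ)
    have hQ₀ : InAdd Q I₀ := hQ.inAdd h₀ hp₀ hi₀
    have hQ₁ : InAdd Q I₁ := hQ.inAdd h₁ hp₁ hi₁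
    have hcogenM : InCogen Q M := (hQ₀.prod hQ₁).inCogen.of_injective
      (LinearMap.prodMap LinearMap.id (LinearMap.range d).subtype)
      (Function.Injective.prodMap Function.injective_id Subtype.val_injective)
    exact ⟨Q, hQ, hQ₀.inGen.trans hgenT, hcogenM.trans hMT.inCogen⟩
  · exact (projectiveDimension_le_iff T 1).2 (hMT.hasProjectiveDimensionLT hpdM)
  · exact (injectiveDimension_le_iff T 1).2 (hMT.hasInjectiveDimensionLT hidM)
  · let D : ModuleCat.{u} Λ := ModuleCat.of Λ (RegularDual R Λ J)
    -- Approximate `DΛ` with kernel `L`, then `L` with kernel `L'`. The aim is `Ext¹(L, L') = 0`,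
    -- which splits the second approximation and puts `L` in `add T`.
    obtain ⟨m, p, hp, hL, hL1⟩ := exists_approximation_of_inGen R (M := D) hTf hDf
      (hTI₀.inGen.trans (inGen_of_injective ε hε hDi hDf)) hext hTI₀ hTK ε g hε hεg hg
    let L : ModuleCat.{u} Λ := ModuleCat.of Λ (LinearMap.ker p)
    have hLf : Module.Finite Λ L := inferInstanceAs (Module.Finite Λ (LinearMap.ker p))
    obtain ⟨k, p', hp', hL', hL1'⟩ := exists_approximation_of_inGen R (M := L) hTf hLf
      hL hext hTI₀ hTK ε g hε hεg hg
    let L' : ModuleCat.{u} Λ := ModuleCat.of Λ (LinearMap.ker p')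
    have hD3 := hasProjectiveDimensionLT_of_globalDim_le_two hgl D hDf
    -- `L'` is a quotient of a power of the injective `I₀`, so `Ext²(DΛ, L')` embeds in an `Ext³(DΛ,
    -- -)`, which vanishes.
    have hD2 : Subsingleton (Ext.{u} D L' 2) := by
      obtain ⟨c, q, hq⟩ := hgenT.trans hL'
      exact ext_subsingleton_right_quotient (X := ModuleCat.of Λ (LinearMap.ker q))
        (Y := ModuleCat.of Λ (Fin c → I₀)) (Z := L') (f := (LinearMap.ker q).subtype)
        Subtype.val_injective (LinearMap.exact_subtype_ker_map q) hq
        (ext_subsingleton_of_injective ((InAdd.pi fun _ => InAdd.refl I₀).injective hi₀) D 1)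
        (HasProjectiveDimensionLT.subsingleton D 3 3 le_rfl _)
    have hTm : InAdd T (ModuleCat.of Λ (Fin m → T)) := InAdd.pi fun _ => InAdd.refl T
    -- `Ext¹(L, L')` lies between `Ext¹(T^m, L')`, zero by the choice of the second approximation,
    -- and `Ext²(DΛ, L')`.
    have hLL' : Subsingleton (Ext.{u} L L' 1) :=
      ext_subsingleton_left_sub (X := L) (Y := ModuleCat.of Λ (Fin m → T)) (Z := D)
        (f := (LinearMap.ker p).subtype) Subtype.val_injective
        (LinearMap.exact_subtype_ker_map p) hp (hTm.ext_left hL1') hD2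
    obtain ⟨s, hs⟩ := exists_section_of_ext_one (X := L') (Y := ModuleCat.of Λ (Fin k → T)) (Z := L)
      (f := (LinearMap.ker p').subtype) Subtype.val_injective
      (LinearMap.exact_subtype_ker_map p') hp' hLL'
    exact ⟨L, ModuleCat.of Λ (Fin m → T), (LinearMap.ker p).subtype, p, ⟨k, s, p', hs⟩, hTm,
      Subtype.val_injective, LinearMap.exact_subtype_ker_map p, hp⟩

theorem exists_isTilting_isCotilting_of_isAuslander (R : Type u) [CommRing R] [IsArtinianRing R]
    [Algebra R Λ] [Module.Finite R Λ] (h : IsAuslander Λ) :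
    ∃ T : ModuleCat.{u} Λ, InC T ∧ IsTilting T ∧ IsCotilting R T := by
  have : IsNoetherianRing Λ := IsNoetherianRing.of_finite R Λ
  obtain ⟨I, hp₀, hp₁⟩ := exists_resolution_of_two_le_domDim h.2
  obtain ⟨J, e, he⟩ := exists_isInjectiveEnvelope (ModuleCat.of R (R ⧸ Ring.jacobson R))
  have : Module.Finite R (LinearMap.range e) := inferInstance
  have hDf : Module.Finite Λ (RegularDual R Λ J) := regularDual_finite R Λ J _ he.essential
  have hDi : Module.Injective Λ (RegularDual R Λ J) :=
    regularDual_injective R Λ J he.injective_module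
  -- The terms of a minimal injective resolution carry no finiteness by definition. An essential
  -- extension of a finitely generated module embeds in a power of `DΛ`, hence is finitely
  -- generated.
  have hfin (E : ModuleCat.{u} Λ) (A : Submodule Λ E) (hA : Module.Finite Λ A)
      (hess : ∀ N : Submodule Λ E, N ⊓ A = ⊥ → N = ⊥) : Module.Finite Λ E :=
    (inCogen_of_essential hDi A hess
      (inCogen_regularDual R Λ he hDf (ModuleCat.of Λ A) hA)).finite hDf
  have h₀ : Module.Finite Λ (I.I 0) :=
    hfin _ _ (Module.Finite.range (M := Λ) I.ε) I.essential_zero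
  have h₁ : Module.Finite Λ (I.I 1) := hfin _ _ inferInstance (I.essential_succ 0)
  exact exists_isTilting_isCotilting R h.1 h₀ h₁ hp₀ (I.injective_module 0) hp₁
    (I.injective_module 1) I.injective_ε I.exact_zero he hDf hDi

end Backward
end ArtinAlg

theorem mainTheorem5 (R : Type u) [CommRing R] [IsArtinianRing R]
    (Λ : Type u) [Ring Λ] [Algebra R Λ] [Module.Finite R Λ]
    (hgl : ArtinAlg.globalDim Λ < ⊤) :
    (∃ T : ModuleCat.{u} Λ,
        ArtinAlg.InC T ∧ ArtinAlg.IsTilting T ∧ ArtinAlg.IsCotilting R T) ↔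
      ArtinAlg.IsAuslander Λ :=
  ⟨fun ⟨_, hC, hT, hT'⟩ => ArtinAlg.isAuslander_of_isTilting R hgl hC hT hT'.id_le_one,
    ArtinAlg.exists_isTilting_isCotilting_of_isAuslander R⟩
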